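/- **Setting.** Fix a first-order language $\mathscr L$: a collection $\mathscr L_q$ of quantifier symbols and a collection $\mathscr L_\omega$ of finitary connectives, with a designated nullary connective $e$ and a designated binary connective $\otimes$. For a many-sorted signature $Sg$ (sorts, typed function and relation symbols), terms $M:\tau\,[\Gamma]$ and formulas $\phi\,[\Gamma]$ in context are built as usual from variables, function symbols, relation symbols, equality formulas $M=_\sigma N$, connectives, and quantifiers $\Omega_{x:\sigma}$; expressions are taken up to renaming of bound and free variables. Assertions are equations in context $M=N:\tau\,[\Gamma]$ and sequents in context $\phi_1,\dots,\phi_n\vdash\psi\,[\Gamma]$ ($n\ge 0$); an $Sg$-theory is a set of assertions. A logic $\mathcal L$ is a closure operator on the lattice of $Sg$-theories, for each $Sg$, all of whose closed theories are closed under equational logic (reflexivity, symmetry, transitivity, substitution of equals for a variable). An $\mathcal L$-theory is a closed theory. An object $(\mathcal C,P)$ of $\mathbf{FA}$ is a category $\mathcal C$ with designated finite products and a functor $P:\mathcal C^{op}\to\mathbf{Pos}$ with: (1) an $\mathscr L_\omega$-algebra structure on each $P(c)$, preserved by all $P(f)$; (2) elements $Eq_c\in P(c\times c)$; (3) for each $\Omega\in\mathscr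 L_q$, maps (not necessarily monotone) $\Omega_{b,c}:P(b\times c)\to P(b)$, natural in $b$; such that (4) each $(P(c),\otimes,e)$ is a monoid; (5) $\Omega_{b,1}\circ P(\pi_1)=\mathrm{id}$ and $\Omega_{b,c\times d}\circ P(a)=\Omega_{b,c}\circ\Omega_{b\times c,d}$, with $a:b\times(c\times d)\cong(b\times c)\times d$; (6) $Eq_1=e_{1\times1}$, and for $c=c_1\times c_2$, $Eq_c=P(\langle\pi_1\pi_1^{c,c},\pi_1\pi_2^{c,c}\rangle)Eq_{c_1}\otimes P(\langle\pi_2\pi_1^{c,c},\pi_2\pi_2^{c,c}\rangle)Eq_{c_2}$. An $Sg$-structure $S$ in $(\mathcal C,P)$ assigns objects $S[\![\sigma]\!]$ to sorts, morphisms $S[\![\sigma_1]\!]\times\cdots\times S[\![\sigma_n]\!]\to S[\![\tau]\!]$ to function symbols and elements of $P(S[\![\sigma_1]\!]\times\cdots\times S[\![\sigma_n]\!])$ to relation symbols (products bracketed to the left, a one-fold product being the object itself), and interprets terms and formulas in context in the usual recursive way. It satisfies $M=N\,[\Gamma]$ if $S[\![M]\!]=S[\![N]\!]$, and $\phi_1,\dots,\phi_n\vdash\psi\,[\Gamma]$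 if $S[\![\phi_1]\!]\otimes\cdots\otimes S[\![\phi_n]\!]\le S[\![\psi]\!]$ (the left side being $e$ if $n=0$); it is a $T$-model if it satisfies all assertions of $T$. A morphism $F:(\mathcal C,P)\to(\mathcal D,Q)$ is a finite-product-preserving functor $F^o:\mathcal C\to\mathcal D$ with a natural transformation $F^p:P\Rightarrow Q\circ F^o$ (monotone components) that preserves the connectives, the quantifier maps and the elements $Eq_c$, up to the comparison isomorphisms $F^o(b\times c)\cong F^ob\times F^oc$. The image $F(S)$ of a structure $S$ is given by $\sigma\mapsto F^o(S[\![\sigma]\!])$, $f\mapsto F^o(S[\![f]\!])\circ a^{-1}$, $R\mapsto Q(a^{-1})(F^p(S[\![R]\!]))$, with $a$ the comparison isomorphisms for finite products. A 2-cell $F\Rightarrow H$ is a natural transformation $\eta:F^o\Rightarrow H^o$ with $F^p_c=Q(\eta_c)\circ H^p_c$ for all $c$; it is a 2-isomorphism if $\eta$ is a natural isomorphism. For a theory $T$, the category $\mathcal C_T$ has contexts (up to renaming) as objects; a morphism $\Gamma'\to\Gamma$ is a list of terms in context $\Gamma'$, one for each variable of $\Gamma$ and of its sort, modulo equations in $T$;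 composition is substitution and products are concatenations. $P_T(\Gamma)$ is the set of formulas in context $\Gamma$ modulo $\phi\sim\psi\iff\phi\vdash\psi,\ \psi\vdash\phi\in T$, ordered by $\phi\vdash\psi\in T$; $P_T$ acts by substitution, connectives act syntactically, $\Omega_{\Gamma,\Gamma'}(\phi)=\Omega_{y_1:\tau_1}\cdots\Omega_{y_m:\tau_m}\phi$ for $\Gamma'=y_1:\tau_1,\dots,y_m:\tau_m$, and $Eq_\Gamma$ is $x_1=x_1'\otimes\cdots\otimes x_n=x_n'$ ($e$ if $n=0$). The logic $\mathcal L$ is *adequate* if for every $\mathcal L$-theory $T$ this data is well defined and $(\mathcal C_T,P_T)$ is an object of $\mathbf{FA}$. The generic structure (generic $T$-model) $G$ in $(\mathcal C_T,P_T)$ is given by $G[\![\sigma]\!]=[x:\sigma]$, $G[\![f]\!]=[f(x_1,\dots,x_n)]$, $G[\![R]\!]=[R(x_1,\dots,x_n)]$. **Theorem.** Let $\mathcal L$ be adequate and $T$ an $\mathcal L$-theory. For each object $(\mathcal C,P)$ of $\mathbf{FA}$ and each $T$-model $S$ in $(\mathcal C,P)$ there is a morphism $\overline S:(\mathcal C_T,P_T)\to(\mathcal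 C,P)$ in $\mathbf{FA}$ with $\overline S(G)=S$, and every morphism $H:(\mathcal C_T,P_T)\to(\mathcal C,P)$ with $H(G)=S$ is 2-isomorphic to $\overline S$. -/

import Mathlib

open CategoryTheory MonoidalCategory CartesianMonoidalCategory Opposite

universe l s u v w u' v' w'

noncomputable section

namespace FOL

/-! ### Languages, signatures, terms and formulas in context -/

/-- A first-order language: quantifier symbols and propositional connectives with arities,
with a designated nullary connective `e` and a designated binary connective `tensor`. -/
structure Language where
  Quant : Type l
  Conn : ℕ → Type l
  e : Conn 0
  tensor : Conn 2

/-- A many-sorted signature.  Here and below a list of sorts `σ₁, …, σₙ` is stored with its last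
entry first, i.e. as `[σₙ, …, σ₁]`, so that adjoining a variable to a context is `List.cons`. -/
structure Signature where
  Srt : Type s
  Fn : Type s
  dom : Fn → List Srt
  cod : Fn → Srt
  Rel : Type s
  relDom : Rel → List Srt

/-- `Var Γ σ` is the set of variables of sort `σ` in the context `Γ`; a context, taken up to
renaming of its variables, is a list of sorts and its variables are the positions in the list. -/
inductive Var {S : Type s} : List S → S → Type s
  | z {Γ : List S} {σ : S} : Var (σ :: Γ) σ
  | s {Γ : List S} {σ τ : S} : Var Γ σ → Var (τ :: Γ) σ

/-- Terms in context `M : τ [Γ]`. The arguments of a function symbol are indexed by the positions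
in its list of argument sorts. -/
inductive Term (Sg : Signature.{s}) (Γ : List Sg.Srt) : Sg.Srt → Type s
  | var {σ : Sg.Srt} : Var Γ σ → Term Sg Γ σ
  | app (f : Sg.Fn) (args : ∀ τ, Var (Sg.dom f) τ → Term Sg Γ τ) : Term Sg Γ (Sg.cod f)

/-- Formulas in context `φ : prop [Γ]`, up to renaming of bound and free variables. -/
inductive Formula (𝓛 : Language.{l}) (Sg : Signature.{s}) : List Sg.Srt → Type (max l s)
  | rel {Γ : List Sg.Srt} (R : Sg.Rel) (args : ∀ τ, Var (Sg.relDom R) τ → Term Sg Γ τ) :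
      Formula 𝓛 Sg Γ
  | eq {Γ : List Sg.Srt} {σ : Sg.Srt} (M N : Term Sg Γ σ) : Formula 𝓛 Sg Γ
  | conn {Γ : List Sg.Srt} {n : ℕ} (k : 𝓛.Conn n) (φ : Fin n → Formula 𝓛 Sg Γ) : Formula 𝓛 Sg Γ
  | quant {Γ : List Sg.Srt} (Q : 𝓛.Quant) (σ : Sg.Srt) (φ : Formula 𝓛 Sg (σ :: Γ)) :
      Formula 𝓛 Sg Γ

/-- Assertions: equations in context and sequents in context. -/
inductive Assertion (𝓛 : Language.{l}) (Sg : Signature.{s}) : Type (max l s)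
  | eqn {Γ : List Sg.Srt} {σ : Sg.Srt} (M N : Term Sg Γ σ) : Assertion 𝓛 Sg
  | seq {Γ : List Sg.Srt} (Φ : List (Formula 𝓛 Sg Γ)) (ψ : Formula 𝓛 Sg Γ) : Assertion 𝓛 Sg

/-- Theories over the signature `Sg`, ordered by inclusion. -/
abbrev Theory (𝓛 : Language.{l}) (Sg : Signature.{s}) := Set (Assertion 𝓛 Sg)

/-! ### Substitution -/

section Substitution

variable {𝓛 : Language.{l}} {Sg : Signature.{s}}

/-- `Subst Sg Γ Δ`: a term in context `Δ` for each variable of `Γ`. -/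
abbrev Subst (Sg : Signature.{s}) (Γ Δ : List Sg.Srt) := ∀ τ, Var Γ τ → Term Sg Δ τ

/-- Simultaneous substitution in a term. -/
def Term.subst {Γ Δ : List Sg.Srt} (γ : Subst Sg Γ Δ) : ∀ {τ : Sg.Srt}, Term Sg Γ τ → Term Sg Δ τ
  | _, .var x => γ _ x
  | _, .app f args => .app f fun τ x => (args τ x).subst γ

/-- Renaming of the variables of a term. -/
def Term.rename {Γ Δ : List Sg.Srt} (ρ : ∀ τ, Var Γ τ → Var Δ τ) {τ : Sg.Srt} (M : Term Sg Γ τ) :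
    Term Sg Δ τ :=
  M.subst fun τ x => .var (ρ τ x)

/-- The extension of a substitution under a binder. -/
def Subst.lift {Γ Δ : List Sg.Srt} (σ : Sg.Srt) (γ : Subst Sg Γ Δ) : Subst Sg (σ :: Γ) (σ :: Δ)
  | _, .z => .var .z
  | _, .s x => (γ _ x).rename fun _ y => .s y

/-- Simultaneous capture-avoiding substitution in a formula. -/
def Formula.subst : ∀ {Γ Δ : List Sg.Srt}, Subst Sg Γ Δ → Formula 𝓛 Sg Γ → Formula 𝓛 Sg Δ
  | _, _, γ, .rel R args => .rel R fun τ x => (args τ x).subst γ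
  | _, _, γ, .eq M N => .eq (M.subst γ) (N.subst γ)
  | _, _, γ, .conn k φ => .conn k fun i => (φ i).subst γ
  | _, _, γ, .quant Q σ φ => .quant Q σ (φ.subst (γ.lift σ))

theorem Term.subst_var {Γ : List Sg.Srt} {τ : Sg.Srt} (M : Term Sg Γ τ) :
    M.subst (fun _ x => .var x) = M := by
  induction M with
  | var x => rfl
  | app f args ih => simp only [Term.subst, ih]

theorem Term.subst_subst {Γ Δ Θ : List Sg.Srt} (γ : Subst Sg Γ Δ) (δ : Subst Sg Δ Θ) {τ : Sg.Srt}
    (M : Term Sg Γ τ) : (M.subst γ).subst δ = M.subst fun τ x => (γ τ x).subst δ := by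
  induction M with
  | var x => rfl
  | app f args ih => simp only [Term.subst, ih]

theorem Subst.lift_var (Γ : List Sg.Srt) (σ : Sg.Srt) :
    Subst.lift σ (fun _ x => Term.var x : Subst Sg Γ Γ) = fun _ x => Term.var x := by
  funext τ x
  cases x <;> rfl

theorem Subst.lift_comp {Γ Δ Θ : List Sg.Srt} (σ : Sg.Srt) (γ : Subst Sg Γ Δ) (δ : Subst Sg Δ Θ) :
    Subst.lift σ (fun τ x => (γ τ x).subst δ) =
      fun τ x => (Subst.lift σ γ τ x).subst (Subst.lift σ δ) := by
  funext τ x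
  cases x with
  | z => rfl
  | s x => simp only [Subst.lift, Term.rename, Term.subst_subst, Term.subst]

theorem Formula.subst_var {Γ : List Sg.Srt} (φ : Formula 𝓛 Sg Γ) :
    φ.subst (fun _ x => .var x) = φ := by
  induction φ with
  | rel R args => simp only [Formula.subst, Term.subst_var]
  | eq M N => simp only [Formula.subst, Term.subst_var]
  | conn k φ ih => simp only [Formula.subst, ih]
  | quant Q σ φ ih => simp only [Formula.subst, Subst.lift_var, ih]

theorem Formula.subst_subst {Γ Δ Θ : List Sg.Srt} (γ : Subst Sg Γ Δ) (δ : Subst Sg Δ Θ)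
    (φ : Formula 𝓛 Sg Γ) : (φ.subst γ).subst δ = φ.subst fun τ x => (γ τ x).subst δ := by
  induction φ generalizing Δ Θ with
  | rel R args => simp only [Formula.subst, Term.subst_subst]
  | eq M N => simp only [Formula.subst, Term.subst_subst]
  | conn k φ ih => simp only [Formula.subst, ih]
  | quant Q σ φ ih => simp only [Formula.subst, Subst.lift_comp, ih]

/-- The variables of `Γ` in the context `Γ, Γ'`. -/
def Var.left {S : Type s} {Γ : List S} : ∀ (Γ' : List S) {τ : S}, Var Γ τ → Var (Γ' ++ Γ) τ
  | [], _, x => x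
  | _ :: Γ', _, x => .s (Var.left Γ' x)

/-- The variables of `Γ'` in the context `Γ, Γ'`. -/
def Var.right {S : Type s} (Γ : List S) : ∀ {Γ' : List S} {τ : S}, Var Γ' τ → Var (Γ' ++ Γ) τ
  | _, _, .z => .z
  | _, _, .s x => .s (Var.right Γ x)

/-- The substitution out of `Γ, Γ'` given by `γ` on `Γ` and `δ` on `Γ'`. -/
def Subst.pair {Γ Θ : List Sg.Srt} (γ : Subst Sg Γ Θ) :
    ∀ {Γ' : List Sg.Srt}, Subst Sg Γ' Θ → Subst Sg (Γ' ++ Γ) Θ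
  | [], _, _, x => γ _ x
  | _ :: _, δ, _, .z => δ _ .z
  | _ :: _, δ, _, .s x => Subst.pair γ (fun _ y => δ _ (.s y)) _ x

/-- Auxiliary: the part of the next substitution on the variables of `Γ, x : σ`. -/
def Subst.single₀ {Γ Γ' : List Sg.Srt} {σ : Sg.Srt} (M : Term Sg (Γ' ++ Γ) σ) :
    Subst Sg (σ :: Γ) (Γ' ++ Γ)
  | _, .z => M
  | _, .s x => .var (x.left Γ')

/-- The substitution `[M/x]` out of the context `Γ, x : σ, Γ'`, where `M : σ [Γ, Γ']`. -/
def Subst.single {Γ Γ' : List Sg.Srt} {σ : Sg.Srt} (M : Term Sg (Γ' ++ Γ) σ) :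
    Subst Sg (Γ' ++ σ :: Γ) (Γ' ++ Γ) :=
  Subst.pair (Subst.single₀ M) (fun _ x => .var (x.right Γ))

theorem Subst.pair_left {Γ Θ : List Sg.Srt} (γ : Subst Sg Γ Θ) {Γ' : List Sg.Srt}
    (δ : Subst Sg Γ' Θ) {τ : Sg.Srt} (x : Var Γ τ) : Subst.pair γ δ τ (x.left Γ') = γ τ x := by
  induction Γ' with
  | nil => rfl
  | cons σ Γ' ih => exact ih _

theorem Subst.pair_right {Γ Θ : List Sg.Srt} (γ : Subst Sg Γ Θ) {Γ' : List Sg.Srt}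
    (δ : Subst Sg Γ' Θ) {τ : Sg.Srt} (x : Var Γ' τ) :
    Subst.pair γ δ τ (x.right Γ) = δ τ x := by
  induction x with
  | z => rfl
  | s x ih => exact ih _

theorem Var.left_or_right {S : Type s} {Γ Γ' : List S} {τ : S} (x : Var (Γ' ++ Γ) τ) :
    (∃ y : Var Γ τ, x = y.left Γ') ∨ ∃ y : Var Γ' τ, x = y.right Γ := by
  induction Γ' with
  | nil => exact Or.inl ⟨x, rfl⟩
  | cons σ Γ' ih =>
    cases x with
    | z => exact Or.inr ⟨.z, rfl⟩
    | s x =>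
      rcases ih x with ⟨y, hy⟩ | ⟨y, hy⟩
      · exact Or.inl ⟨y, by rw [hy]; rfl⟩
      · exact Or.inr ⟨.s y, by rw [hy]; rfl⟩

theorem Var.left_injective {S : Type s} {Γ : List S} (Γ' : List S) {τ : S} :
    Function.Injective (Var.left Γ' : Var Γ τ → Var (Γ' ++ Γ) τ) := by
  induction Γ' with
  | nil => exact fun _ _ h => h
  | cons σ Γ' ih => exact fun _ _ h => ih (by injection h)

theorem Var.right_injective {S : Type s} (Γ : List S) {Γ' : List S} {τ : S} :
    Function.Injective (Var.right Γ : Var Γ' τ → Var (Γ' ++ Γ) τ) := by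
  intro x
  induction x with
  | z =>
    intro y h
    cases y with
    | z => rfl
    | s y => cases h
  | s x ih =>
    intro y h
    cases y with
    | z => cases h
    | s y =>
      have h2 : Var.right Γ x = Var.right Γ y := by injection h
      rw [ih h2]

end Substitution

/-! ### Equational logic and logics -/

/-- `T` is closed under the rules of equational logic: reflexivity, symmetry, transitivity, and
from `M = M' : σ [Δ]` and `N = N' : τ [Γ, x : σ, Γ']` infer `N[M/x] = N'[M'/x] : τ [Γ, Γ']`,
where the variables of `Δ` are among those of `Γ, Γ'`; as contexts are taken up to renaming,
the latter is expressed by an injection `ρ`. -/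
structure EqClosed {𝓛 : Language.{l}} {Sg : Signature.{s}} (T : Theory 𝓛 Sg) : Prop where
  refl : ∀ {Γ : List Sg.Srt} {σ : Sg.Srt} (M : Term Sg Γ σ), Assertion.eqn M M ∈ T
  symm : ∀ {Γ : List Sg.Srt} {σ : Sg.Srt} {M N : Term Sg Γ σ},
    Assertion.eqn M N ∈ T → Assertion.eqn N M ∈ T
  trans : ∀ {Γ : List Sg.Srt} {σ : Sg.Srt} {M N K : Term Sg Γ σ},
    Assertion.eqn M N ∈ T → Assertion.eqn N K ∈ T → Assertion.eqn M K ∈ T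
  sub : ∀ {Γ Γ' Δ : List Sg.Srt} {σ τ : Sg.Srt} (ρ : ∀ κ, Var Δ κ → Var (Γ' ++ Γ) κ),
    (∀ κ, Function.Injective (ρ κ)) →
    ∀ {M M' : Term Sg Δ σ} {N N' : Term Sg (Γ' ++ σ :: Γ) τ},
    Assertion.eqn M M' ∈ T → Assertion.eqn N N' ∈ T →
    Assertion.eqn (N.subst (Subst.single (M.rename ρ))) (N'.subst (Subst.single (M'.rename ρ))) ∈ T

/-- A (first-order) logic: a closure operator on the lattice of `Sg`-theories for each signature
`Sg`, which satisfies the rules of equational logic. -/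
structure Logic (𝓛 : Language.{l}) where
  cl : ∀ Sg : Signature.{s}, ClosureOperator (Theory 𝓛 Sg)
  eqClosed : ∀ (Sg : Signature.{s}) (T : Theory 𝓛 Sg), EqClosed (cl Sg T)

/-- `T` is an `L`-theory. -/
def Logic.IsTheory {𝓛 : Language.{l}} (L : Logic.{l, s} 𝓛) {Sg : Signature.{s}}
    (T : Theory 𝓛 Sg) : Prop :=
  L.cl Sg T = T

section EqLemmas

variable {𝓛 : Language.{l}} {Sg : Signature.{s}} {T : Theory 𝓛 Sg}

theorem EqClosed.weaken (h : EqClosed T) {Γ Δ : List Sg.Srt} {σ : Sg.Srt}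
    (ρ : ∀ κ, Var Δ κ → Var Γ κ) (hρ : ∀ κ, Function.Injective (ρ κ)) {M M' : Term Sg Δ σ}
    (hM : Assertion.eqn M M' ∈ T) : Assertion.eqn (M.rename ρ) (M'.rename ρ) ∈ T :=
  h.sub (Γ := Γ) (Γ' := []) (N := .var .z) (N' := .var .z) ρ hρ hM (h.refl _)

theorem EqClosed.subst_aux (h : EqClosed T) {Θ : List Sg.Srt} {τ : Sg.Srt} (Γ : List Sg.Srt)
    (N N' : Term Sg (Γ ++ Θ) τ) (γ γ' : Subst Sg Γ Θ)
    (hγ : ∀ κ x, Assertion.eqn (γ κ x) (γ' κ x) ∈ T) (hN : Assertion.eqn N N' ∈ T) :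
    Assertion.eqn (N.subst (Subst.pair (fun _ x => .var x) γ))
      (N'.subst (Subst.pair (fun _ x => .var x) γ')) ∈ T := by
  induction Γ with
  | nil =>
    have e1 : ∀ (δ : Subst Sg [] Θ),
        (Subst.pair (fun _ x => .var x) δ : Subst Sg ([] ++ Θ) Θ) = fun _ x => .var x := by
      intro δ; rfl
    rw [e1, e1]
    have e2 : ∀ K : Term Sg ([] ++ Θ) τ, K.subst (fun _ x => Term.var x) = K := Term.subst_var
    rw [e2, e2]
    exact hN
  | cons σ Γ ih =>
    have key := h.sub (Γ := Γ ++ Θ) (Γ' := []) (fun κ x => Var.left Γ x)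
      (fun κ => Var.left_injective Γ) (hγ σ .z) hN
    have := ih _ _ (fun κ x => γ κ (.s x)) (fun κ x => γ' κ (.s x)) (fun κ x => hγ κ (.s x)) key
    have e3 : ∀ (K : Term Sg (σ :: (Γ ++ Θ)) τ) (δ : Subst Sg (σ :: Γ) Θ),
        (K.subst (Subst.single (Γ := Γ ++ Θ) (Γ' := [])
            ((δ σ .z).rename fun κ x => Var.left Γ x))).subst
          (Subst.pair (fun _ x => .var x) fun κ x => δ κ (.s x)) =
        K.subst (Subst.pair (Γ' := σ :: Γ) (fun _ x => .var x) δ) := by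
      intro K δ
      rw [Term.subst_subst]
      congr 1
      funext κ x
      cases x with
      | z =>
        change (((δ σ .z).rename fun κ x => Var.left Γ x)).subst _ = δ σ .z
        rw [Term.rename, Term.subst_subst]
        simp only [Term.subst, Subst.pair_left]
        exact Term.subst_var _
      | s x => rfl
    rw [← e3 N γ, ← e3 N' γ']
    exact this

/-- Simultaneous substitution respects provable equality. -/
theorem EqClosed.subst (h : EqClosed T) {Γ Θ : List Sg.Srt} {τ : Sg.Srt}
    {N N' : Term Sg Γ τ} {γ γ' : Subst Sg Γ Θ}
    (hγ : ∀ κ x, Assertion.eqn (γ κ x) (γ' κ x) ∈ T) (hN : Assertion.eqn N N' ∈ T) :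
    Assertion.eqn (N.subst γ) (N'.subst γ') ∈ T := by
  have := h.subst_aux Γ _ _ γ γ' hγ
    (h.weaken (fun κ x => Var.right Θ x) (fun κ => Var.right_injective Θ) hN)
  have e : ∀ (K : Term Sg Γ τ) (δ : Subst Sg Γ Θ),
      (K.rename fun κ x => Var.right Θ x).subst (Subst.pair (fun _ x => .var x) δ) =
        K.subst δ := by
    intro K δ
    rw [Term.rename, Term.subst_subst]
    simp only [Term.subst, Subst.pair_right]
  rwa [e, e] at this

end EqLemmas

/-! ### Prop-categories -/

/-- A prop-category: a category with designated finite products (a terminal object `𝟙_ C` and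
binary products `c ⊗ d`) and a contravariant functor `P` to posets, together with the operations
on it that interpret a language `𝓛` (for now without any laws). -/
structure PropCat (𝓛 : Language.{l}) where
  C : Type u
  [cat : Category.{v} C]
  [prod : CartesianMonoidalCategory C]
  P : Cᵒᵖ ⥤ PartOrd.{w}
  conn : ∀ (c : C) {n : ℕ}, 𝓛.Conn n → (Fin n → P.obj (op c)) → P.obj (op c)
  Eq : ∀ c : C, P.obj (op (c ⊗ c))
  quant : 𝓛.Quant → ∀ b c : C, P.obj (op (b ⊗ c)) → P.obj (op b)

attribute [instance] PropCat.cat PropCat.prod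

namespace PropCat

variable {𝓛 : Language.{l}}

/-- The poset `P(c)`. -/
abbrev Pred (X : PropCat.{l, u, v, w} 𝓛) (c : X.C) : Type w := X.P.obj (op c)

/-- The monotone map `P(f) : P(d) → P(c)` for `f : c ⟶ d`. -/
def pull (X : PropCat.{l, u, v, w} 𝓛) {c d : X.C} (f : c ⟶ d) : X.Pred d →o X.Pred c :=
  (X.P.map f.op).hom

/-- The interpretation of the designated connective `e` in `P(c)`. -/
def e (X : PropCat.{l, u, v, w} 𝓛) (c : X.C) : X.Pred c := X.conn c 𝓛.e ![]

/-- The interpretation of the designated connective `⊗` in `P(c)`. -/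
def tens (X : PropCat.{l, u, v, w} 𝓛) {c : X.C} (a b : X.Pred c) : X.Pred c :=
  X.conn c 𝓛.tensor ![a, b]

/-- `a₁ ⊗ ⋯ ⊗ aₙ`, which is `e` if `n = 0`. -/
def tensList (X : PropCat.{l, u, v, w} 𝓛) {c : X.C} : List (X.Pred c) → X.Pred c
  | [] => X.e c
  | a :: as => as.foldl X.tens a

/-- The prop-categories that belong to `Ob(FA)`. -/
structure IsFA (X : PropCat.{l, u, v, w} 𝓛) : Prop where
  /-- each `P(f)` is a homomorphism for the connectives -/
  pull_conn : ∀ {c d : X.C} (f : c ⟶ d) {n : ℕ} (k : 𝓛.Conn n) (φ : Fin n → X.Pred d),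
    X.pull f (X.conn d k φ) = X.conn c k fun i => X.pull f (φ i)
  /-- `Ω_{(-), c} : P(- × c) ⇒ P` is natural -/
  quant_natural : ∀ (Q : 𝓛.Quant) {b b' : X.C} (f : b' ⟶ b) (c : X.C) (φ : X.Pred (b ⊗ c)),
    X.quant Q b' c (X.pull (f ▷ c) φ) = X.pull f (X.quant Q b c φ)
  /-- `(P(c), ⊗, e)` is a monoid -/
  tens_assoc : ∀ {c : X.C} (x y z : X.Pred c), X.tens (X.tens x y) z = X.tens x (X.tens y z)
  e_tens : ∀ {c : X.C} (x : X.Pred c), X.tens (X.e c) x = x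
  tens_e : ∀ {c : X.C} (x : X.Pred c), X.tens x (X.e c) = x
  /-- `Ω_{b,1} ∘ P(π₁) = id` -/
  quant_unit : ∀ (Q : 𝓛.Quant) (b : X.C) (φ : X.Pred b),
    X.quant Q b (𝟙_ X.C) (X.pull (fst b (𝟙_ X.C)) φ) = φ
  /-- `Ω_{b, c × d} ∘ P(a) = Ω_{b,c} ∘ Ω_{b × c, d}` where `a : b × (c × d) ⟶ (b × c) × d` -/
  quant_prod : ∀ (Q : 𝓛.Quant) (b c d : X.C) (φ : X.Pred ((b ⊗ c) ⊗ d)),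
    X.quant Q b (c ⊗ d) (X.pull (α_ b c d).inv φ) = X.quant Q b c (X.quant Q (b ⊗ c) d φ)
  Eq_unit : X.Eq (𝟙_ X.C) = X.e (𝟙_ X.C ⊗ 𝟙_ X.C)
  Eq_prod : ∀ c₁ c₂ : X.C, X.Eq (c₁ ⊗ c₂) =
    X.tens
      (X.pull (lift (fst (c₁ ⊗ c₂) (c₁ ⊗ c₂) ≫ fst c₁ c₂) (snd (c₁ ⊗ c₂) (c₁ ⊗ c₂) ≫ fst c₁ c₂))
        (X.Eq c₁))
      (X.pull (lift (fst (c₁ ⊗ c₂) (c₁ ⊗ c₂) ≫ snd c₁ c₂) (snd (c₁ ⊗ c₂) (c₁ ⊗ c₂) ≫ snd c₁ c₂))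
        (X.Eq c₂))

end PropCat

/-- The objects of the 2-category `FA`. -/
structure FA (𝓛 : Language.{l}) extends PropCat.{l, u, v, w} 𝓛 where
  isFA : toPropCat.IsFA

/-! ### Products of lists of objects -/

section Products

variable {S : Type s} {C : Type u} [Category.{v} C] [CartesianMonoidalCategory C] (o : S → C)

/-- `o σ₁ × ⋯ × o σₙ` (bracketed to the left), for the list `σ₁, …, σₙ`; this is `1` for `n = 0`
and `o σ₁` for `n = 1`. -/
def listProd : List S → C
  | [] => 𝟙_ C
  | [σ] => o σ
  | σ :: τ :: Γ => listProd (τ :: Γ) ⊗ o σ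

/-- The projections from `o σ₁ × ⋯ × o σₙ`. -/
def listProj : ∀ (Γ : List S) (τ : S), Var Γ τ → (listProd o Γ ⟶ o τ)
  | [_], _, .z => 𝟙 _
  | _ :: τ :: Γ, _, .z => snd (listProd o (τ :: Γ)) _
  | _ :: τ :: Γ, _, .s x => fst (listProd o (τ :: Γ)) _ ≫ listProj (τ :: Γ) _ x

/-- The morphism `⟨f₁, …, fₙ⟩ : c ⟶ o σ₁ × ⋯ × o σₙ`. -/
def listLift {c : C} : ∀ (Γ : List S), (∀ τ, Var Γ τ → (c ⟶ o τ)) → (c ⟶ listProd o Γ)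
  | [], _ => toUnit c
  | [σ], f => f σ .z
  | σ :: τ :: Γ, f => lift (listLift (τ :: Γ) fun κ x => f κ (.s x)) (f σ .z)

/-- The change-in-product isomorphism
`(o σ₁ × ⋯ × o σₙ) × o σ ⟶ o σ₁ × ⋯ × o σₙ × o σ` (not the identity only if `n = 0`). -/
def listSnoc (σ : S) : ∀ Γ : List S, listProd o Γ ⊗ o σ ⟶ listProd o (σ :: Γ)
  | [] => snd _ _
  | _ :: _ => 𝟙 _

/-- The change-in-product isomorphism `F (o σ₁ × ⋯ × o σₙ) ≅ F (o σ₁) × ⋯ × F (o σₙ)` for a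
functor `F` that preserves finite products. -/
def listComparison {D : Type u'} [Category.{v'} D] [CartesianMonoidalCategory D] (F : C ⥤ D)
    [Limits.PreservesFiniteProducts F] :
    ∀ Γ : List S, F.obj (listProd o Γ) ≅ listProd (fun σ => F.obj (o σ)) Γ
  | [] => preservesTerminalIso F
  | [_] => Iso.refl _
  | σ :: τ :: Γ =>
    prodComparisonIso F (listProd o (τ :: Γ)) (o σ) ≪≫
      whiskerRightIso (listComparison F (τ :: Γ)) (F.obj (o σ))

end Products

/-! ### Structures, interpretation and models -/

/-- An `Sg`-structure in a prop-category. -/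
structure Structure {𝓛 : Language.{l}} (Sg : Signature.{s}) (X : PropCat.{l, u, v, w} 𝓛) where
  sort : Sg.Srt → X.C
  fn : ∀ f : Sg.Fn, listProd sort (Sg.dom f) ⟶ sort (Sg.cod f)
  rel : ∀ R : Sg.Rel, X.Pred (listProd sort (Sg.relDom R))

namespace Structure

variable {𝓛 : Language.{l}} {Sg : Signature.{s}} {X : PropCat.{l, u, v, w} 𝓛}

/-- `⟦M : τ [Γ]⟧`. -/
def term (S : Structure Sg X) {Γ : List Sg.Srt} :
    ∀ {τ : Sg.Srt}, Term Sg Γ τ → (listProd S.sort Γ ⟶ S.sort τ)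
  | _, .var x => listProj S.sort Γ _ x
  | _, .app f args => listLift S.sort (Sg.dom f) (fun τ x => S.term (args τ x)) ≫ S.fn f

/-- `⟦φ [Γ]⟧`. -/
def formula (S : Structure Sg X) : ∀ {Γ : List Sg.Srt}, Formula 𝓛 Sg Γ → X.Pred (listProd S.sort Γ)
  | _, .rel R args => X.pull (listLift S.sort (Sg.relDom R) fun τ x => S.term (args τ x)) (S.rel R)
  | _, .eq (σ := σ) M N => X.pull (lift (S.term M) (S.term N)) (X.Eq (S.sort σ))
  | _, .conn k φ => X.conn _ k fun i => S.formula (φ i)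
  | Γ, .quant Q σ φ =>
    X.quant Q (listProd S.sort Γ) (S.sort σ) (X.pull (listSnoc S.sort σ Γ) (S.formula φ))

/-- `S` satisfies an assertion. -/
def Sat (S : Structure Sg X) : Assertion 𝓛 Sg → Prop
  | .eqn M N => S.term M = S.term N
  | .seq Φ ψ => X.tensList (Φ.map fun φ => S.formula φ) ≤ S.formula ψ

/-- The theory of `S`. -/
def theory (S : Structure Sg X) : Theory 𝓛 Sg := {a | S.Sat a}

/-- `S` is a `T`-model. -/
def IsModel (S : Structure Sg X) (T : Theory 𝓛 Sg) : Prop := T ≤ S.theory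

end Structure

/-! ### Morphisms and 2-cells of `FA` -/

/-- Morphisms `(C, P) ⟶ (D, Q)`. -/
structure Hom {𝓛 : Language.{l}} (X : PropCat.{l, u, v, w} 𝓛) (Y : PropCat.{l, u', v', w'} 𝓛) where
  functor : X.C ⥤ Y.C
  preserves : Limits.PreservesFiniteProducts functor
  app : ∀ c : X.C, X.Pred c →o Y.Pred (functor.obj c)
  naturality : ∀ {c d : X.C} (f : c ⟶ d) (φ : X.Pred d),
    app c (X.pull f φ) = Y.pull (functor.map f) (app d φ)
  app_conn : ∀ (c : X.C) {n : ℕ} (k : 𝓛.Conn n) (φ : Fin n → X.Pred c),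
    app c (X.conn c k φ) = Y.conn (functor.obj c) k fun i => app c (φ i)
  app_quant : ∀ (Q : 𝓛.Quant) (b c : X.C) (φ : X.Pred (b ⊗ c)),
    app b (X.quant Q b c φ) =
      Y.quant Q (functor.obj b) (functor.obj c)
        (Y.pull (prodComparisonIso functor b c).inv (app (b ⊗ c) φ))
  app_Eq : ∀ c : X.C,
    app (c ⊗ c) (X.Eq c) = Y.pull (prodComparisonIso functor c c).hom (Y.Eq (functor.obj c))

attribute [instance] Hom.preserves

namespace Hom

variable {𝓛 : Language.{l}} {X : PropCat.{l, u, v, w} 𝓛} {Y : PropCat.{l, u', v', w'} 𝓛}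

/-- The image `F(S)` of a structure `S` under a morphism `F`. -/
def mapStructure (F : Hom X Y) {Sg : Signature.{s}} (S : Structure Sg X) : Structure Sg Y where
  sort σ := F.functor.obj (S.sort σ)
  fn f := (listComparison S.sort F.functor (Sg.dom f)).inv ≫ F.functor.map (S.fn f)
  rel R := Y.pull (listComparison S.sort F.functor (Sg.relDom R)).inv (F.app _ (S.rel R))

/-- 2-cells `F ⇒ H`: natural transformations `η` with `F^p = Qη ∘ H^p`. -/
structure TwoCell (F H : Hom X Y) where
  nat : F.functor ⟶ H.functor
  comm : ∀ (c : X.C) (φ : X.Pred c), F.app c φ = Y.pull (nat.app c) (H.app c φ)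

/-- There is a 2-isomorphism from `F` to `H`. -/
def TwoIsomorphic (F H : Hom X Y) : Prop := ∃ η : TwoCell F H, IsIso η.nat

end Hom

/-! ### The classifying prop-category of a theory -/

section Classifying

variable {𝓛 : Language.{l}} {Sg : Signature.{s}}

/-- The classifying prop-category of `T` can be constructed: besides equational logic (which makes
composition of classes of terms by substitution well defined), entailment in `T` is a preorder on
the formulas in each context, and substitution (as a monotone map), the connectives and the
quantifiers are well defined on classes of formulas. -/
structure Constructible (T : Theory 𝓛 Sg) : Prop extends EqClosed T where
  le_refl : ∀ {Γ : List Sg.Srt} (φ : Formula 𝓛 Sg Γ), Assertion.seq [φ] φ ∈ T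
  le_trans : ∀ {Γ : List Sg.Srt} {φ ψ θ : Formula 𝓛 Sg Γ},
    Assertion.seq [φ] ψ ∈ T → Assertion.seq [ψ] θ ∈ T → Assertion.seq [φ] θ ∈ T
  subst_le : ∀ {Γ Δ : List Sg.Srt} {γ γ' : Subst Sg Γ Δ} {φ ψ : Formula 𝓛 Sg Γ},
    (∀ τ x, Assertion.eqn (γ τ x) (γ' τ x) ∈ T) → Assertion.seq [φ] ψ ∈ T →
    Assertion.seq [φ.subst γ] (ψ.subst γ') ∈ T
  conn_congr : ∀ {Γ : List Sg.Srt} {n : ℕ} (k : 𝓛.Conn n) {φ ψ : Fin n → Formula 𝓛 Sg Γ},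
    (∀ i, Assertion.seq [φ i] (ψ i) ∈ T ∧ Assertion.seq [ψ i] (φ i) ∈ T) →
    Assertion.seq [.conn k φ] (.conn k ψ) ∈ T
  quant_congr : ∀ {Γ : List Sg.Srt} (Q : 𝓛.Quant) (σ : Sg.Srt) {φ ψ : Formula 𝓛 Sg (σ :: Γ)},
    Assertion.seq [φ] ψ ∈ T → Assertion.seq [ψ] φ ∈ T →
    Assertion.seq [.quant Q σ φ] (.quant Q σ ψ) ∈ T

variable {T : Theory 𝓛 Sg}

/-- The objects of `C_T`: contexts, up to renaming. -/
@[ext]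
structure Ctx (h : Constructible T) where
  sorts : List Sg.Srt

/-- Componentwise provable equality of lists of terms in a common context. -/
def substSetoid (h : Constructible T) (Γ Δ : List Sg.Srt) : Setoid (Subst Sg Γ Δ) where
  r γ δ := ∀ τ x, Assertion.eqn (γ τ x) (δ τ x) ∈ T
  iseqv :=
    { refl := fun _ _ _ => h.refl _
      symm := fun H τ x => h.symm (H τ x)
      trans := fun H K τ x => h.trans (H τ x) (K τ x) }

/-- `C_T`: a morphism `Δ ⟶ Γ` is a list of terms in context `Δ`, one for each variable of `Γ`, up
to provable equality; composition is substitution. -/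
instance ctxCategory (h : Constructible T) : Category.{s} (Ctx h) where
  Hom Δ Γ := Quotient (substSetoid h Γ.sorts Δ.sorts)
  id Γ := Quotient.mk _ fun _ x => .var x
  comp {Θ Δ Γ} := Quotient.map₂ (sa := substSetoid h Δ.sorts Θ.sorts)
    (sb := substSetoid h Γ.sorts Δ.sorts)
    (fun δ γ τ x => (γ τ x).subst δ)
    (fun _ _ hδ _ _ hγ τ x => h.toEqClosed.subst hδ (hγ τ x))
  id_comp := by
    rintro Δ Γ ⟨γ⟩
    exact congrArg (Quotient.mk _) (funext fun τ => funext fun x => Term.subst_var _)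
  comp_id := by
    rintro Δ Γ ⟨γ⟩
    rfl
  assoc := by
    rintro Ξ Θ Δ Γ ⟨ε⟩ ⟨δ⟩ ⟨γ⟩
    exact congrArg (Quotient.mk _) (funext fun τ => funext fun x => (Term.subst_subst _ _ _).symm)

/-- The morphism of `C_T` given by a list of terms. -/
def ctxHom (h : Constructible T) {Δ Γ : Ctx h} (γ : Subst Sg Γ.sorts Δ.sorts) : Δ ⟶ Γ :=
  Quotient.mk (substSetoid h Γ.sorts Δ.sorts) γ

/-- The product of the contexts `Γ` and `Γ'` is their concatenation `Γ, Γ'`. -/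
def ctxFan (h : Constructible T) (Γ Γ' : Ctx h) : Limits.BinaryFan Γ Γ' :=
  Limits.BinaryFan.mk (P := (⟨Γ'.sorts ++ Γ.sorts⟩ : Ctx h))
    (ctxHom h fun _ x => .var (Var.left Γ'.sorts x))
    (ctxHom h fun _ x => .var (Var.right Γ.sorts x))

def ctxFanIsLimit (h : Constructible T) (Γ Γ' : Ctx h) : Limits.IsLimit (ctxFan h Γ Γ') :=
  Limits.BinaryFan.IsLimit.mk _
    (fun {Θ} f g => Quotient.map₂ (sa := substSetoid h Γ.sorts Θ.sorts)
      (sb := substSetoid h Γ'.sorts Θ.sorts)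
      (sc := substSetoid h (Γ'.sorts ++ Γ.sorts) Θ.sorts) (fun γ δ => Subst.pair γ δ)
      (by
        intro γ γ' hγ δ δ' hδ τ x
        rcases Var.left_or_right x with ⟨y, rfl⟩ | ⟨y, rfl⟩
        · rw [Subst.pair_left, Subst.pair_left]; exact hγ τ y
        · rw [Subst.pair_right, Subst.pair_right]; exact hδ τ y) f g)
    (by
      rintro Θ ⟨γ⟩ ⟨δ⟩
      exact congrArg (Quotient.mk _) (funext fun τ => funext fun x => Subst.pair_left _ _ _))
    (by
      rintro Θ ⟨γ⟩ ⟨δ⟩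
      exact congrArg (Quotient.mk _) (funext fun τ => funext fun x => Subst.pair_right _ _ _))
    (by
      rintro Θ ⟨γ⟩ ⟨δ⟩ ⟨ε⟩ h1 h2
      refine Quotient.sound fun τ x => ?_
      rcases Var.left_or_right (Γ := Γ.sorts) (Γ' := Γ'.sorts) x with ⟨y, rfl⟩ | ⟨y, rfl⟩
      · have := Quotient.exact h1 τ y
        have e := Subst.pair_left γ δ y
        dsimp only
        rw [e]; exact this
      · have := Quotient.exact h2 τ y
        have e := Subst.pair_right γ δ y
        dsimp only
        rw [e]; exact this)

theorem Var.nil_elim {S : Type s} {τ : S} (x : Var ([] : List S) τ) : False := nomatch x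

def ctxNilIsTerminal (h : Constructible T) : Limits.IsTerminal (⟨[]⟩ : Ctx h) :=
  Limits.IsTerminal.ofUniqueHom (fun _ => ctxHom h fun _ x => x.nil_elim.elim) (by
    rintro Γ ⟨γ⟩
    exact congrArg (Quotient.mk _) (funext fun τ => funext fun x => x.nil_elim.elim))

/-- The designated finite products of `C_T`. -/
instance ctxProducts (h : Constructible T) : CartesianMonoidalCategory (Ctx h) :=
  .ofChosenFiniteProducts ⟨_, ctxNilIsTerminal h⟩ fun Γ Γ' => ⟨ctxFan h Γ Γ', ctxFanIsLimit h Γ Γ'⟩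

/-- Mutual entailment of formulas in context. -/
def formulaSetoid (h : Constructible T) (Γ : List Sg.Srt) : Setoid (Formula 𝓛 Sg Γ) where
  r φ ψ := Assertion.seq [φ] ψ ∈ T ∧ Assertion.seq [ψ] φ ∈ T
  iseqv :=
    { refl := fun _ => ⟨h.le_refl _, h.le_refl _⟩
      symm := fun H => ⟨H.2, H.1⟩
      trans := fun H K => ⟨h.le_trans H.1 K.1, h.le_trans K.2 H.2⟩ }

/-- `P_T(Γ)`: formulas in context `Γ` modulo mutual entailment. -/
def PForm (h : Constructible T) (Γ : List Sg.Srt) : Type (max l s) := Quotient (formulaSetoid h Γ)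

/-- The class of a formula. -/
def PForm.mk (h : Constructible T) {Γ : List Sg.Srt} (φ : Formula 𝓛 Sg Γ) : PForm h Γ :=
  Quotient.mk (formulaSetoid h Γ) φ

instance (h : Constructible T) (Γ : List Sg.Srt) : PartialOrder (PForm h Γ) where
  le := Quotient.lift₂ (s₁ := formulaSetoid h Γ) (s₂ := formulaSetoid h Γ)
    (fun φ ψ => Assertion.seq [φ] ψ ∈ T)
    (fun _ _ _ _ H K => propext
      ⟨fun A => h.le_trans H.2 (h.le_trans A K.1), fun A => h.le_trans H.1 (h.le_trans A K.2)⟩)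
  le_refl := by
    rintro ⟨φ⟩
    exact h.le_refl φ
  le_trans := by
    rintro ⟨φ⟩ ⟨ψ⟩ ⟨θ⟩ H K
    exact h.le_trans H K
  le_antisymm := by
    rintro ⟨φ⟩ ⟨ψ⟩ H K
    exact Quotient.sound ⟨H, K⟩

/-- `P_T(γ)`: simultaneous substitution. -/
def PForm.map (h : Constructible T) {Δ Γ : Ctx h} (f : Δ ⟶ Γ) :
    PForm h Γ.sorts →o PForm h Δ.sorts where
  toFun := Quotient.map₂ (sa := substSetoid h Γ.sorts Δ.sorts) (sb := formulaSetoid h Γ.sorts)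
    (sc := formulaSetoid h Δ.sorts) (fun γ φ => φ.subst γ)
    (fun _ _ hγ _ _ hφ => ⟨h.subst_le hγ hφ.1, h.subst_le (fun τ x => h.symm (hγ τ x)) hφ.2⟩) f
  monotone' := by
    rcases f with ⟨γ⟩
    rintro ⟨φ⟩ ⟨ψ⟩ H
    exact h.subst_le (fun _ _ => h.refl _) H

/-- The contravariant functor `P_T`. -/
abbrev formulaFunctor (h : Constructible T) : (Ctx h)ᵒᵖ ⥤ PartOrd.{max l s} where
  obj Γ := PartOrd.of (PForm h Γ.unop.sorts)
  map f := PartOrd.ofHom (PForm.map h f.unop)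
  map_id Γ := by
    apply PartOrd.ext
    rintro ⟨φ⟩
    exact congrArg (PForm.mk h) φ.subst_var
  map_comp := by
    rintro ⟨Γ⟩ ⟨Δ⟩ ⟨Θ⟩ ⟨⟨γ⟩⟩ ⟨⟨δ⟩⟩
    apply PartOrd.ext
    rintro ⟨φ⟩
    exact congrArg (PForm.mk h) (φ.subst_subst γ δ).symm

/-- The connectives on `P_T(Γ)`. -/
def PForm.conn (h : Constructible T) {Γ : List Sg.Srt} {n : ℕ} (k : 𝓛.Conn n)
    (a : Fin n → PForm h Γ) : PForm h Γ :=
  Quotient.finLiftOn (S := fun _ => formulaSetoid h Γ) a (fun φ => PForm.mk h (.conn k φ))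
    fun _ _ H => Quotient.sound
      ⟨h.conn_congr k H, h.conn_congr k fun i => ⟨(H i).2, (H i).1⟩⟩

/-- A single quantification `Ω_{x : σ}` on classes of formulas. -/
def PForm.quantOne (h : Constructible T) {Γ : List Sg.Srt} (Q : 𝓛.Quant) (σ : Sg.Srt) :
    PForm h (σ :: Γ) → PForm h Γ :=
  Quotient.map (sa := formulaSetoid h (σ :: Γ)) (sb := formulaSetoid h Γ) (.quant Q σ)
    fun _ _ H => ⟨h.quant_congr Q σ H.1 H.2, h.quant_congr Q σ H.2 H.1⟩

/-- `Ω_{Γ, Γ'}(φ) = Ω_{y₁ : τ₁} ⋯ Ω_{yₘ : τₘ}(φ)` for `Γ' = y₁ : τ₁, …, yₘ : τₘ`. -/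
def PForm.quant (h : Constructible T) (Q : 𝓛.Quant) (Γ : List Sg.Srt) :
    ∀ Γ' : List Sg.Srt, PForm h (Γ' ++ Γ) → PForm h Γ
  | [], a => a
  | σ :: Γ', a => PForm.quant h Q Γ Γ' (PForm.quantOne h Q σ a)

/-- The formula `l(x₁) = r(x₁) ⊗ ⋯ ⊗ l(xₙ) = r(xₙ)`, where `x₁, …, xₙ` are the variables of `Γ`;
for `n = 0` this is `e`. -/
def eqFormula (𝓛 : Language.{l}) {Sg : Signature.{s}} {Δ : List Sg.Srt} :
    ∀ (Γ : List Sg.Srt) (_ _ : ∀ τ, Var Γ τ → Var Δ τ), Formula 𝓛 Sg Δ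
  | [], _, _ => .conn 𝓛.e ![]
  | [σ], l, r => .eq (.var (l σ .z)) (.var (r σ .z))
  | σ :: τ :: Γ, l, r =>
    .conn 𝓛.tensor ![eqFormula 𝓛 (τ :: Γ) (fun κ x => l κ (.s x)) (fun κ x => r κ (.s x)),
      .eq (.var (l σ .z)) (.var (r σ .z))]

/-- The classifying prop-category `(C_T, P_T)`. -/
abbrev classifying (h : Constructible T) : PropCat.{l, s, s, max l s} 𝓛 where
  C := Ctx h
  P := formulaFunctor h
  conn Γ _ k a := PForm.conn h (Γ := Γ.sorts) k a
  Eq Γ := PForm.mk h (Γ := Γ.sorts ++ Γ.sorts)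
    (eqFormula 𝓛 Γ.sorts (fun _ x => Var.left Γ.sorts x) (fun _ x => Var.right Γ.sorts x))
  quant Q Γ Γ' a := PForm.quant h Q Γ.sorts Γ'.sorts a

/-- In `C_T`, the context `x₁ : σ₁, …, xₙ : σₙ` is the product of the contexts `xᵢ : σᵢ`. -/
theorem listProd_ctx (h : Constructible T) : ∀ Γ : List Sg.Srt,
    listProd (C := Ctx h) (fun σ => ⟨[σ]⟩) Γ = ⟨Γ⟩
  | [] => rfl
  | [_] => rfl
  | σ :: τ :: Γ => congrArg (fun Δ : Ctx h => (⟨σ :: Δ.sorts⟩ : Ctx h)) (listProd_ctx h (τ :: Γ))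

/-- The term `f(x₁, …, xₙ)` as a one-term list. -/
def fnSubst (f : Sg.Fn) : Subst Sg [Sg.cod f] (Sg.dom f)
  | _, .z => .app f fun _ x => .var x

/-- The generic structure `G` in `(C_T, P_T)`: `G⟦σ⟧ = [x : σ]`, `G⟦f⟧` is the class of
`f(x₁, …, xₙ)` and `G⟦R⟧` is the class of `R(x₁, …, xₙ)`. -/
def generic (h : Constructible T) : Structure Sg (classifying h) where
  sort σ := (⟨[σ]⟩ : Ctx h)
  fn f := eqToHom (C := Ctx h) (listProd_ctx h (Sg.dom f)) ≫
    ctxHom h (Δ := ⟨Sg.dom f⟩) (Γ := ⟨[Sg.cod f]⟩) (fnSubst f)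
  rel R := (classifying h).pull (d := (⟨Sg.relDom R⟩ : Ctx h))
    (eqToHom (C := Ctx h) (listProd_ctx h (Sg.relDom R)))
    (PForm.mk h (.rel R fun _ x => .var x))

end Classifying

/-- A logic is adequate if for each `L`-theory `T`, over any signature, the classifying
prop-category `(C_T, P_T)` can be constructed and belongs to `Ob(FA)`. -/
def Logic.Adequate {𝓛 : Language.{l}} (L : Logic.{l, s} 𝓛) : Prop :=
  ∀ (Sg : Signature.{s}) (T : Theory 𝓛 Sg), L.IsTheory T →
    ∃ h : Constructible T, (classifying h).IsFA

namespace Logic.Adequate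

variable {𝓛 : Language.{l}} {L : Logic.{l, s} 𝓛} {Sg : Signature.{s}} {T : Theory 𝓛 Sg}

theorem constructible (hL : L.Adequate) (hT : L.IsTheory T) : Constructible T :=
  (hL Sg T hT).1

/-- The classifying prop-category of an `L`-theory as an object of `FA`. -/
def classifyingFA (hL : L.Adequate) (hT : L.IsTheory T) : FA.{l, s, s, max l s} 𝓛 where
  toPropCat := classifying (hL.constructible hT)
  isFA := (hL Sg T hT).2

/-- The generic model of an `L`-theory in its classifying prop-category. -/
def genericModel (hL : L.Adequate) (hT : L.IsTheory T) :
    Structure Sg (hL.classifyingFA hT).toPropCat :=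
  generic (hL.constructible hT)

end Logic.Adequate

end FOL

end

/-! A `T`-model interprets syntax, and this interpretation is itself the required morphism. A
context goes to the product of the interpretations of its sorts, a list of terms to the tuple of
their interpretations, and a formula to its interpretation. Classes modulo `T` are respected because
`S` satisfies `T`. Functoriality and naturality are the substitution lemmas `term_subst` and
`formula_subst`, whose quantifier case is the naturality of the quantifier maps. The laws of `FA`
match the syntax of a whole context with the semantics. The unit and product laws for the quantifier
maps turn a block of quantifiers into one quantification over a product (`modelPred_quant`), and
those for `Eq` do the same for equality of contexts (`formula_eqFormula`). Finite products are
preserved since the product over `Γ, Γ'` splits (`isIso_listAppend`). The generic structure goes to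
`S` on the nose: a one-fold product is the object itself, and the comparison isomorphisms of this
functor are identities. For uniqueness, let `H` send the generic structure to `S`. Each context is a
product of one-variable contexts and `H` preserves products, so `ctxComparison` is an isomorphism
from the value of `H` at `Γ` to the product of the `S.sort σ`. These isomorphisms are natural by
induction on terms (`map_ctxTerm`) and compatible with predicates by induction on formulas
(`app_mk`), because every term and formula arises from the generic ones by operations that `H`
preserves. They form the 2-isomorphism. -/

noncomputable section

namespace FOL

/-! ### Products of lists of objects -/

/-- A family on the variables of `Γ, Γ'` from families on the variables of `Γ` and of `Γ'`. -/
def Var.elim {S : Type s} {A : S → Type v} {Γ : List S} (f : ∀ τ, Var Γ τ → A τ) :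
    ∀ {Γ' : List S}, (∀ τ, Var Γ' τ → A τ) → ∀ τ, Var (Γ' ++ Γ) τ → A τ
  | [], _, τ, x => f τ x
  | _ :: _, g, _, .z => g _ .z
  | _ :: _, g, τ, .s x => Var.elim f (fun _ y => g _ (.s y)) τ x

theorem Var.elim_left {S : Type s} {A : S → Type v} {Γ Γ' : List S} (f : ∀ τ, Var Γ τ → A τ)
    (g : ∀ τ, Var Γ' τ → A τ) {τ : S} (x : Var Γ τ) : Var.elim f g τ (x.left Γ') = f τ x := by
  induction Γ' with
  | nil => rfl
  | cons σ Γ' ih => exact ih _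

theorem Var.elim_right {S : Type s} {A : S → Type v} {Γ Γ' : List S} (f : ∀ τ, Var Γ τ → A τ)
    (g : ∀ τ, Var Γ' τ → A τ) {τ : S} (x : Var Γ' τ) : Var.elim f g τ (x.right Γ) = g τ x := by
  induction x with
  | z => rfl
  | s x ih => exact ih _

section Products

variable {S : Type s} {C : Type u} [Category.{v} C] [CartesianMonoidalCategory C] (o : S → C)

/-- The bracketing of `listProd`, with its special cases for zero and one factors, is dealt with
here and in `listLift_listProj`, so that later identities can be checked on projections. -/
theorem listProd_hom_ext {c : C} : ∀ (Γ : List S) {f g : c ⟶ listProd o Γ},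
    (∀ τ x, f ≫ listProj o Γ τ x = g ≫ listProj o Γ τ x) → f = g
  | [], _, _, _ => toUnit_unique _ _
  | [_], f, g, h =>
    (Category.comp_id f).symm.trans ((h _ .z).trans (Category.comp_id g))
  | σ :: τ :: Γ, f, g, h => by
    refine CartesianMonoidalCategory.hom_ext _ _ (listProd_hom_ext (τ :: Γ) fun κ x => ?_)
      (h _ .z)
    exact (Category.assoc _ _ _).trans ((h κ (.s x)).trans (Category.assoc _ _ _).symm)

@[simp]
theorem listLift_listProj {c : C} : ∀ (Γ : List S) (f : ∀ τ, Var Γ τ → (c ⟶ o τ)) (τ : S)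
    (x : Var Γ τ), listLift o Γ f ≫ listProj o Γ τ x = f τ x
  | [_], _, _, .z => Category.comp_id _
  | _ :: _ :: _, _, _, .z => lift_snd _ _
  | _ :: τ :: Γ, f, _, .s x =>
    (lift_fst_assoc _ _ _).trans (listLift_listProj (τ :: Γ) (fun κ x => f κ (.s x)) _ x)

theorem comp_listLift {c d : C} (g : d ⟶ c) (Γ : List S) (f : ∀ τ, Var Γ τ → (c ⟶ o τ)) :
    g ≫ listLift o Γ f = listLift o Γ fun τ x => g ≫ f τ x :=
  listProd_hom_ext o Γ fun τ x => by simp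

theorem listLift_eq_id (Γ : List S) : listLift o Γ (listProj o Γ) = 𝟙 _ :=
  listProd_hom_ext o Γ fun τ x => by simp

@[simp]
theorem listSnoc_listProj_z (σ : S) (Γ : List S) :
    listSnoc o σ Γ ≫ listProj o (σ :: Γ) σ .z = snd _ _ := by
  cases Γ with
  | nil => exact Category.comp_id _
  | cons κ Γ => exact Category.id_comp _

@[simp]
theorem listSnoc_listProj_s (σ : S) {Γ : List S} {τ : S} (x : Var Γ τ) :
    listSnoc o σ Γ ≫ listProj o (σ :: Γ) τ (.s x) = fst _ _ ≫ listProj o Γ τ x := by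
  cases Γ with
  | nil => exact x.nil_elim.elim
  | cons κ Γ => exact Category.id_comp _

/-- The comparison from the product of `Γ, Γ'` to the product of those of `Γ` and `Γ'`. -/
def listAppend (Γ Γ' : List S) : listProd o (Γ' ++ Γ) ⟶ listProd o Γ ⊗ listProd o Γ' :=
  lift (listLift o Γ fun τ x => listProj o (Γ' ++ Γ) τ (x.left Γ'))
    (listLift o Γ' fun τ x => listProj o (Γ' ++ Γ) τ (x.right Γ))

/-- Both objects are products of the same family, indexed by the variables of `Γ, Γ'`, each of which
lies in exactly one of the two parts. -/
instance isIso_listAppend (Γ Γ' : List S) : IsIso (listAppend o Γ Γ') := by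
  refine ⟨listLift o (Γ' ++ Γ) (Var.elim (fun τ x => fst _ _ ≫ listProj o Γ τ x)
    fun τ x => snd _ _ ≫ listProj o Γ' τ x), ?_, ?_⟩
  · refine listProd_hom_ext o _ fun τ x => ?_
    rw [Category.assoc, listLift_listProj, Category.id_comp]
    rcases Var.left_or_right x with ⟨y, rfl⟩ | ⟨y, rfl⟩
    · rw [Var.elim_left, listAppend, lift_fst_assoc, listLift_listProj]
    · rw [Var.elim_right, listAppend, lift_snd_assoc, listLift_listProj]
  · refine CartesianMonoidalCategory.hom_ext _ _
      (listProd_hom_ext o _ fun τ x => ?_) (listProd_hom_ext o _ fun τ x => ?_)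
    · simp [listAppend, Var.elim_left]
    · simp [listAppend, Var.elim_right]

section Comparison

variable {D : Type u'} [Category.{v'} D] [CartesianMonoidalCategory D] (F : C ⥤ D)
  [Limits.PreservesFiniteProducts F]

/-- This characterizes the recursively built comparison, so its definition need not be unfolded
again. -/
theorem listComparison_hom_listProj : ∀ (Γ : List S) (τ : S) (x : Var Γ τ),
    (listComparison o F Γ).hom ≫ listProj (fun σ => F.obj (o σ)) Γ τ x =
      F.map (listProj o Γ τ x)
  | [σ], _, .z => (Category.comp_id _).trans (F.map_id (o σ)).symm
  | σ :: τ :: Γ, _, .z => by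
    change (_ ≫ (listComparison o F (τ :: Γ)).hom ▷ F.obj (o σ)) ≫ snd _ _ = F.map (snd _ _)
    rw [Category.assoc, whiskerRight_snd]
    exact prodComparison_snd ..
  | σ :: τ :: Γ, κ, .s x => by
    change (_ ≫ (listComparison o F (τ :: Γ)).hom ▷ F.obj (o σ)) ≫ fst _ _ ≫
      listProj (fun σ => F.obj (o σ)) (τ :: Γ) κ x = F.map (fst _ _ ≫ listProj o (τ :: Γ) κ x)
    rw [Category.assoc, whiskerRight_fst_assoc, listComparison_hom_listProj, F.map_comp]
    exact prodComparison_fst_assoc ..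

end Comparison

end Products

/-! ### Substitution in interpreted expressions -/

namespace PropCat

variable {𝓛 : Language.{l}} (X : PropCat.{l, u, v, w} 𝓛)

theorem pull_id {c : X.C} (φ : X.Pred c) : X.pull (𝟙 c) φ = φ := by
  simp [pull]

theorem pull_comp {b c d : X.C} (f : b ⟶ c) (g : c ⟶ d) (φ : X.Pred d) :
    X.pull (f ≫ g) φ = X.pull f (X.pull g φ) := by
  simp [pull]

variable {X}

theorem IsFA.pull_e (hX : X.IsFA) {c d : X.C} (f : c ⟶ d) : X.pull f (X.e d) = X.e c := by
  rw [e, hX.pull_conn]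
  exact congrArg _ (Subsingleton.elim _ _)

theorem IsFA.pull_tens (hX : X.IsFA) {c d : X.C} (f : c ⟶ d) (a b : X.Pred d) :
    X.pull f (X.tens a b) = X.tens (X.pull f a) (X.pull f b) := by
  rw [tens, hX.pull_conn]
  refine congrArg _ (funext fun i => ?_)
  fin_cases i <;> rfl

theorem IsFA.pull_Eq_unit (hX : X.IsFA) {c : X.C} (f : c ⟶ 𝟙_ X.C ⊗ 𝟙_ X.C) :
    X.pull f (X.Eq (𝟙_ X.C)) = X.e c := by
  rw [hX.Eq_unit, hX.pull_e]

/-- The product law for `Eq` read on generalized elements: two pairs are equal when their components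
are. This is the inductive step of `formula_eqFormula`. -/
theorem IsFA.pull_Eq_prod (hX : X.IsFA) {b c d : X.C} (f f' : b ⟶ c) (g g' : b ⟶ d) :
    X.pull (lift (lift f g) (lift f' g')) (X.Eq (c ⊗ d)) =
      X.tens (X.pull (lift f f') (X.Eq c)) (X.pull (lift g g') (X.Eq d)) := by
  rw [hX.Eq_prod, hX.pull_tens, ← X.pull_comp, ← X.pull_comp, comp_lift, comp_lift]
  simp only [lift_fst_assoc, lift_snd_assoc, lift_fst, lift_snd]

end PropCat

namespace Structure

variable {𝓛 : Language.{l}} {Sg : Signature.{s}} {X : PropCat.{l, u, v, w} 𝓛} (S : Structure Sg X)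

/-- The interpretation of a list of terms. -/
def subst {Γ Δ : List Sg.Srt} (γ : Subst Sg Γ Δ) : listProd S.sort Δ ⟶ listProd S.sort Γ :=
  listLift S.sort Γ fun τ x => S.term (γ τ x)

@[simp]
theorem subst_listProj {Γ Δ : List Sg.Srt} (γ : Subst Sg Γ Δ) (τ : Sg.Srt) (x : Var Γ τ) :
    S.subst γ ≫ listProj S.sort Γ τ x = S.term (γ τ x) :=
  listLift_listProj ..

theorem term_subst {Γ Δ : List Sg.Srt} (γ : Subst Sg Γ Δ) {τ : Sg.Srt} (M : Term Sg Γ τ) :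
    S.term (M.subst γ) = S.subst γ ≫ S.term M := by
  induction M with
  | var x => exact (S.subst_listProj γ _ x).symm
  | app f args ih =>
    simp only [Term.subst, term, ih]
    rw [← comp_listLift, Category.assoc]

theorem subst_var (Γ : List Sg.Srt) : S.subst (fun _ x => .var x : Subst Sg Γ Γ) = 𝟙 _ :=
  listLift_eq_id ..

theorem subst_comp {Γ Δ Θ : List Sg.Srt} (γ : Subst Sg Γ Δ) (δ : Subst Sg Δ Θ) :
    S.subst (fun τ x => (γ τ x).subst δ) = S.subst δ ≫ S.subst γ := by
  rw [subst, subst, subst, comp_listLift]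
  simp only [term_subst, subst]

/-- Substituting under a binder leaves the new variable alone, so it acts as a product with an
identity. In this form naturality of the quantifier maps applies in `formula_subst`. -/
theorem listSnoc_subst_lift {Γ Δ : List Sg.Srt} (γ : Subst Sg Γ Δ) (σ : Sg.Srt) :
    listSnoc S.sort σ Δ ≫ S.subst (γ.lift σ) = S.subst γ ▷ S.sort σ ≫ listSnoc S.sort σ Γ := by
  refine listProd_hom_ext S.sort _ fun τ x => ?_
  rw [Category.assoc, Category.assoc, subst_listProj]
  cases x with
  | z =>
    rw [listSnoc_listProj_z, whiskerRight_snd]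
    exact listSnoc_listProj_z ..
  | s x =>
    rw [listSnoc_listProj_s, whiskerRight_fst_assoc, subst_listProj, Subst.lift, Term.rename,
      term_subst, ← Category.assoc]
    -- What remains is that weakening by a new variable is interpreted by the first projection.
    congr 1
    refine listProd_hom_ext S.sort _ fun κ y => ?_
    rw [Category.assoc, subst_listProj]
    exact listSnoc_listProj_s ..

theorem formula_subst (hX : X.IsFA) {Γ Δ : List Sg.Srt} (γ : Subst Sg Γ Δ) (φ : Formula 𝓛 Sg Γ) :
    S.formula (φ.subst γ) = X.pull (S.subst γ) (S.formula φ) := by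
  induction φ generalizing Δ with
  | rel R args =>
    simp only [Formula.subst, formula, term_subst]
    rw [← comp_listLift, X.pull_comp]
  | eq M N =>
    simp only [Formula.subst, formula, term_subst]
    rw [← comp_lift, X.pull_comp]
  | conn k φ ih => simp only [Formula.subst, formula, ih, hX.pull_conn]
  | quant Q σ φ ih =>
    simp only [Formula.subst, formula, ih]
    rw [← hX.quant_natural, ← X.pull_comp, ← X.pull_comp, listSnoc_subst_lift]

theorem formula_eqFormula (hX : X.IsFA) {Δ : List Sg.Srt} : ∀ (Γ : List Sg.Srt)
    (l r : ∀ τ, Var Γ τ → Var Δ τ), S.formula (eqFormula 𝓛 Γ l r) =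
      X.pull (lift (S.subst fun τ x => .var (l τ x)) (S.subst fun τ x => .var (r τ x)))
        (X.Eq (listProd S.sort Γ))
  | [], _, _ =>
    (congrArg (X.conn _ 𝓛.e) (Subsingleton.elim _ _)).trans (hX.pull_Eq_unit _).symm
  | [_], _, _ => rfl
  | σ :: τ :: Γ, l, r => by
    have e : S.formula (eqFormula 𝓛 (σ :: τ :: Γ) l r) =
        X.tens (S.formula (eqFormula 𝓛 (τ :: Γ) (fun κ x => l κ (.s x)) fun κ x => r κ (.s x)))
          (S.formula (.eq (.var (l σ .z)) (.var (r σ .z)))) := by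
      refine congrArg _ (funext fun i => ?_)
      fin_cases i <;> rfl
    rw [e, formula_eqFormula hX (τ :: Γ)]
    exact (hX.pull_Eq_prod _ _ _ _).symm

end Structure

/-! ### Splitting the product over a concatenated context -/

section Products

variable {S : Type s} {C : Type u} [Category.{v} C] [CartesianMonoidalCategory C] (o : S → C)

@[simp]
theorem listAppend_fst (Γ Γ' : List S) {τ : S} (x : Var Γ τ) :
    listAppend o Γ Γ' ≫ fst _ _ ≫ listProj o Γ τ x = listProj o (Γ' ++ Γ) τ (x.left Γ') := by
  rw [listAppend, lift_fst_assoc, listLift_listProj]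

@[simp]
theorem listAppend_snd (Γ Γ' : List S) {τ : S} (x : Var Γ' τ) :
    listAppend o Γ Γ' ≫ snd _ _ ≫ listProj o Γ' τ x = listProj o (Γ' ++ Γ) τ (x.right Γ) := by
  rw [listAppend, lift_snd_assoc, listLift_listProj]

theorem inv_listAppend_eq {Γ Γ' : List S} {g : listProd o Γ ⊗ listProd o Γ' ⟶ listProd o (Γ' ++ Γ)}
    (hl : ∀ τ (x : Var Γ τ),
      g ≫ listProj o (Γ' ++ Γ) τ (x.left Γ') = fst _ _ ≫ listProj o Γ τ x)
    (hr : ∀ τ (x : Var Γ' τ),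
      g ≫ listProj o (Γ' ++ Γ) τ (x.right Γ) = snd _ _ ≫ listProj o Γ' τ x) :
    inv (listAppend o Γ Γ') = g := by
  refine IsIso.inv_eq_of_inv_hom_id (CartesianMonoidalCategory.hom_ext _ _
    (listProd_hom_ext o _ fun τ x => ?_) (listProd_hom_ext o _ fun τ x => ?_))
  · simp [hl]
  · simp [hr]

@[simp]
theorem inv_listAppend_left (Γ Γ' : List S) {τ : S} (x : Var Γ τ) :
    inv (listAppend o Γ Γ') ≫ listProj o (Γ' ++ Γ) τ (x.left Γ') = fst _ _ ≫ listProj o Γ τ x := by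
  rw [IsIso.inv_comp_eq, listAppend_fst]

@[simp]
theorem inv_listAppend_right (Γ Γ' : List S) {τ : S} (x : Var Γ' τ) :
    inv (listAppend o Γ Γ') ≫ listProj o (Γ' ++ Γ) τ (x.right Γ) = snd _ _ ≫ listProj o Γ' τ x := by
  rw [IsIso.inv_comp_eq, listAppend_snd]

theorem inv_listAppend_nil (Γ : List S) : inv (listAppend o Γ []) = fst _ _ :=
  inv_listAppend_eq o (fun _ _ => rfl) fun _ x => x.nil_elim.elim

/-- A one-fold product is the object itself, so adjoining one variable is the base case that matches
a single syntactic quantifier. -/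
theorem inv_listAppend_singleton (Γ : List S) (σ : S) :
    inv (listAppend o Γ [σ]) = listSnoc o σ Γ :=
  inv_listAppend_eq o (fun _ x => listSnoc_listProj_s o σ x) fun
    | _, .z => (listSnoc_listProj_z o σ Γ).trans (Category.comp_id _).symm

/-- Products are bracketed to the left, so the last variable is split off by an associator. The two
factors on the right are exactly what `quant_prod` and `quant_natural` consume in `modelPred_quant`.
-/
theorem inv_listAppend_cons (Γ Γ' : List S) (σ τ : S) : inv (listAppend o Γ (σ :: τ :: Γ')) =
    (α_ (listProd o Γ) (listProd o (τ :: Γ')) (o σ)).inv ≫ inv (listAppend o Γ (τ :: Γ')) ▷ o σ := by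
  refine inv_listAppend_eq o (fun κ x => ?_) fun κ x => ?_
  · have : ((α_ (listProd o Γ) (listProd o (τ :: Γ')) (o σ)).inv ≫
        inv (listAppend o Γ (τ :: Γ')) ▷ o σ) ≫ fst _ _ ≫
          listProj o (τ :: Γ' ++ Γ) κ (x.left (τ :: Γ')) = fst _ _ ≫ listProj o Γ κ x := by
      simp only [Category.assoc, whiskerRight_fst_assoc, inv_listAppend_left,
        associator_inv_fst_fst_assoc]
    exact this
  · cases x with
    | z =>
      have : ((α_ (listProd o Γ) (listProd o (τ :: Γ')) (o σ)).inv ≫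
          inv (listAppend o Γ (τ :: Γ')) ▷ o σ) ≫ snd _ _ = snd _ _ ≫ snd _ _ := by simp
      exact this
    | s x =>
      have : ((α_ (listProd o Γ) (listProd o (τ :: Γ')) (o σ)).inv ≫
          inv (listAppend o Γ (τ :: Γ')) ▷ o σ) ≫ fst _ _ ≫
            listProj o (τ :: Γ' ++ Γ) κ (x.right Γ) =
              snd _ _ ≫ fst _ _ ≫ listProj o (τ :: Γ') κ x := by
        simp only [Category.assoc, whiskerRight_fst_assoc, inv_listAppend_right,
          associator_inv_fst_snd_assoc]
      exact this

end Products

/-- Connectives act on a tuple of classes, lifted by `Quotient.finLiftOn`; this computes the lift on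
chosen representatives. -/
theorem PForm.conn_mk {𝓛 : Language.{l}} {Sg : Signature.{s}} {T : Theory 𝓛 Sg}
    (h : Constructible T) {Γ : List Sg.Srt} {n : ℕ} (k : 𝓛.Conn n) (φ : Fin n → Formula 𝓛 Sg Γ) :
    PForm.conn h k (fun i => PForm.mk h (φ i)) = PForm.mk h (.conn k φ) :=
  congrFun (congrFun (Quotient.finLiftOn_mk (S := fun _ => formulaSetoid h Γ) φ) _) _

/-! ### The morphism induced by a model -/

namespace Structure

variable {𝓛 : Language.{l}} {Sg : Signature.{s}} {T : Theory 𝓛 Sg} (h : Constructible T)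
  {X : PropCat.{l, u, v, w} 𝓛} {S : Structure Sg X}

/-- The functor `C_T ⥤ C` induced by a `T`-model: the interpretation of contexts and of lists of
terms. -/
def modelFunctor (hS : S.IsModel T) : Ctx h ⥤ X.C where
  obj Γ := listProd S.sort Γ.sorts
  map {Δ Γ} := Quotient.lift (s := substSetoid h Γ.sorts Δ.sorts) S.subst fun _ _ H =>
    congrArg (listLift S.sort Γ.sorts) (funext fun τ => funext fun x => hS (H τ x))
  map_id Γ := S.subst_var Γ.sorts
  map_comp := by
    rintro Θ Δ Γ ⟨δ⟩ ⟨γ⟩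
    exact S.subst_comp γ δ

instance preservesFiniteProducts_modelFunctor (hS : S.IsModel T) :
    Limits.PreservesFiniteProducts (S.modelFunctor h hS) := by
  -- The projections of contexts are lists of variables, interpreted by tuples of projections; hence
  -- this comparison is `listAppend` by definition.
  have (Γ Δ : Ctx h) : IsIso (prodComparison (S.modelFunctor h hS) Γ Δ) :=
    isIso_listAppend S.sort Γ.sorts Δ.sorts
  have := preservesLimitsOfShape_discrete_walkingPair_of_isIso_prodComparison
    (S.modelFunctor h hS)
  have : IsIso (terminalComparison (S.modelFunctor h hS)) := by
    have e : terminalComparison (S.modelFunctor h hS) = 𝟙 (𝟙_ X.C) := toUnit_unique _ _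
    rw [e]
    exact IsIso.id (𝟙_ X.C)
  have := preservesLimit_empty_of_isIso_terminalComparison (S.modelFunctor h hS)
  have := Limits.preservesLimitsOfShape_pempty_of_preservesTerminal (S.modelFunctor h hS)
  exact .of_preserves_binary_and_terminal _

theorem inv_prodComparisonIso_modelFunctor (hS : S.IsModel T) (Γ Δ : Ctx h) :
    (prodComparisonIso (S.modelFunctor h hS) Γ Δ).inv =
      inv (listAppend S.sort Γ.sorts Δ.sorts) :=
  (IsIso.inv_eq_of_hom_inv_id (f := listAppend S.sort Γ.sorts Δ.sorts)
    (prodComparisonIso (S.modelFunctor h hS) Γ Δ).hom_inv_id).symm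

/-- The interpretation of classes of formulas in a `T`-model. -/
def modelPred (hS : S.IsModel T) (Γ : List Sg.Srt) :
    PForm h Γ →o X.Pred (listProd S.sort Γ) where
  toFun := Quotient.lift (s := formulaSetoid h Γ) S.formula fun _ _ H =>
    -- `tensList` of a single premise is that premise by definition, so satisfying the two sequents
    -- means the two inequalities.
    le_antisymm (hS H.1) (hS H.2)
  monotone' := by
    rintro ⟨φ⟩ ⟨ψ⟩ H
    exact hS H

theorem modelPred_conn (hS : S.IsModel T) {Γ : List Sg.Srt} {n : ℕ} (k : 𝓛.Conn n)
    (a : Fin n → PForm h Γ) : S.modelPred h hS Γ (PForm.conn h k a) =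
      X.conn _ k fun i => S.modelPred h hS Γ (a i) := by
  obtain ⟨φ, rfl⟩ : ∃ φ : Fin n → Formula 𝓛 Sg Γ, (fun i => PForm.mk h (φ i)) = a :=
    ⟨fun i => (a i).out, funext fun i => (a i).out_eq⟩
  rw [PForm.conn_mk]
  rfl

theorem modelPred_quantOne (hS : S.IsModel T) {Γ : List Sg.Srt} (Q : 𝓛.Quant) (σ : Sg.Srt)
    (a : PForm h (σ :: Γ)) : S.modelPred h hS Γ (PForm.quantOne h Q σ a) =
      X.quant Q (listProd S.sort Γ) (S.sort σ)
        (X.pull (listSnoc S.sort σ Γ) (S.modelPred h hS (σ :: Γ) a)) := by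
  rcases a with ⟨φ⟩
  rfl

theorem modelPred_quant (hX : X.IsFA) (hS : S.IsModel T) (Q : 𝓛.Quant) (Γ : List Sg.Srt) :
    ∀ (Γ' : List Sg.Srt) (a : PForm h (Γ' ++ Γ)),
      S.modelPred h hS Γ (PForm.quant h Q Γ Γ' a) =
        X.quant Q (listProd S.sort Γ) (listProd S.sort Γ')
          (X.pull (inv (listAppend S.sort Γ Γ')) (S.modelPred h hS (Γ' ++ Γ) a))
  | [], a => by
    rw [inv_listAppend_nil]
    exact (hX.quant_unit _ _ _).symm
  | [σ], a => by
    rw [inv_listAppend_singleton]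
    exact modelPred_quantOne h hS Q σ a
  | σ :: τ :: Γ', a => by
    rw [inv_listAppend_cons]
    -- The quantifier over the last variable is innermost, so the induction hypothesis applies to
    -- the class already quantified over `σ`. Naturality then moves the splitting isomorphism
    -- inside, and `quant_prod` merges the two quantifications.
    refine (modelPred_quant hX hS Q Γ (τ :: Γ') _).trans ?_
    rw [modelPred_quantOne, ← hX.quant_natural]
    refine (hX.quant_prod Q _ _ _ _).symm.trans ?_
    rw [← X.pull_comp, ← X.pull_comp]
    -- The context `τ :: Γ' ++ Γ` is nonempty, so its `listSnoc` is an identity.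
    erw [Category.comp_id]
    rfl

/-- The morphism `(C_T, P_T) ⟶ (C, P)` of `FA` induced by a `T`-model in `(C, P)`. -/
def modelHom (hX : X.IsFA) (hS : S.IsModel T) : Hom (classifying h) X where
  functor := S.modelFunctor h hS
  preserves := inferInstance
  app Γ := S.modelPred h hS Γ.sorts
  naturality := by
    rintro Δ Γ ⟨γ⟩ ⟨φ⟩
    exact S.formula_subst hX γ φ
  app_conn Γ _ k a := modelPred_conn h hS k a
  app_quant Q Γ Δ a := by
    rw [inv_prodComparisonIso_modelFunctor]
    exact modelPred_quant h hX hS Q Γ.sorts Δ.sorts a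
  app_Eq Γ := S.formula_eqFormula hX Γ.sorts _ _


end Structure

/-! ### Contexts as products of one-variable contexts -/

section ContextComparison

variable {𝓛 : Language.{l}} {Sg : Signature.{s}} {T : Theory 𝓛 Sg} (h : Constructible T)

/-- The list consisting of a single term. -/
def Subst.one {Γ : List Sg.Srt} {σ : Sg.Srt} (M : Term Sg Γ σ) : Subst Sg [σ] Γ
  | _, .z => M

/-- The morphism of `C_T` given by a single term. -/
def ctxTerm {Γ : List Sg.Srt} {σ : Sg.Srt} (M : Term Sg Γ σ) : (⟨Γ⟩ : Ctx h) ⟶ ⟨[σ]⟩ :=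
  ctxHom h (Γ := ⟨[σ]⟩) (Δ := ⟨Γ⟩) (Subst.one M)

theorem ctxHom_comp_ctxTerm {Γ Δ : List Sg.Srt} (γ : Subst Sg Γ Δ) {σ : Sg.Srt}
    (M : Term Sg Γ σ) :
    ctxHom h (Γ := ⟨Γ⟩) (Δ := ⟨Δ⟩) γ ≫ ctxTerm h M = ctxTerm h (M.subst γ) := by
  refine congrArg (ctxHom h (Γ := ⟨[σ]⟩) (Δ := ⟨Δ⟩)) (funext fun τ => funext fun x => ?_)
  rcases x with _ | x
  · rfl
  · exact x.nil_elim.elim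

theorem ctxTerm_var_z {σ : Sg.Srt} :
    ctxTerm h (.var .z : Term Sg [σ] σ) = 𝟙 (⟨[σ]⟩ : Ctx h) := by
  refine congrArg (ctxHom h (Γ := ⟨[σ]⟩) (Δ := ⟨[σ]⟩)) (funext fun τ => funext fun x => ?_)
  rcases x with _ | x
  · rfl
  · exact x.nil_elim.elim

theorem fst_comp_ctxTerm {Γ : Ctx h} {σ τ : Sg.Srt} (x : Var Γ.sorts τ) :
    fst Γ (⟨[σ]⟩ : Ctx h) ≫ ctxTerm h (.var x) =
      ctxTerm h (Γ := σ :: Γ.sorts) (.var (.s x)) :=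
  ctxHom_comp_ctxTerm h _ (.var x)

theorem snd_eq_ctxTerm {Γ : Ctx h} {σ : Sg.Srt} :
    snd Γ (⟨[σ]⟩ : Ctx h) = ctxTerm h (Γ := σ :: Γ.sorts) (.var .z) := by
  refine congrArg (ctxHom h (Γ := ⟨[σ]⟩) (Δ := ⟨σ :: Γ.sorts⟩))
    (funext fun τ => funext fun x => ?_)
  rcases x with _ | x
  · rfl
  · exact x.nil_elim.elim

/-- The equality is between arbitrary contexts so that it can be eliminated by `subst`, which
`listProd_ctx` itself would not allow. -/
theorem eqToHom_fst {Γ Δ : Ctx h} (e : Γ = Δ) {σ τ : Sg.Srt} (x : Var Δ.sorts τ) :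
    eqToHom (congrArg (fun Δ : Ctx h => (⟨σ :: Δ.sorts⟩ : Ctx h)) e) ≫
        ctxTerm h (Γ := σ :: Δ.sorts) (.var (.s x)) =
      fst Γ (⟨[σ]⟩ : Ctx h) ≫ eqToHom e ≫ ctxTerm h (.var x) := by
  subst e
  rw [eqToHom_refl, eqToHom_refl, Category.id_comp, Category.id_comp, fst_comp_ctxTerm]

theorem eqToHom_snd {Γ Δ : Ctx h} (e : Γ = Δ) {σ : Sg.Srt} :
    eqToHom (congrArg (fun Δ : Ctx h => (⟨σ :: Δ.sorts⟩ : Ctx h)) e) ≫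
        ctxTerm h (Γ := σ :: Δ.sorts) (.var .z) = snd Γ (⟨[σ]⟩ : Ctx h) := by
  subst e
  rw [eqToHom_refl, Category.id_comp, snd_eq_ctxTerm]

/-- The iterated product and the context agree only by a proved equality; this shows that transport
along it takes variables to projections. -/
theorem eqToHom_listProd_ctx : ∀ (Γ : List Sg.Srt) (τ : Sg.Srt) (x : Var Γ τ),
    eqToHom (C := Ctx h) (listProd_ctx h Γ) ≫ ctxTerm h (.var x) =
      listProj (C := Ctx h) (fun σ => ⟨[σ]⟩) Γ τ x
  | [_], _, .z => (Category.id_comp _).trans (ctxTerm_var_z h)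
  | _ :: τ :: Γ, _, .z => eqToHom_snd h (listProd_ctx h (τ :: Γ))
  | _ :: τ :: Γ, _, .s x => (eqToHom_fst h (listProd_ctx h (τ :: Γ)) x).trans
      (congrArg (fst _ _ ≫ ·) (eqToHom_listProd_ctx (τ :: Γ) _ x))

variable {D : Type u} [Category.{v} D] [CartesianMonoidalCategory D] (F : Ctx h ⥤ D)
  [Limits.PreservesFiniteProducts F]

/-- The change-in-product isomorphism out of the value of a finite-product-preserving functor at a
context. -/
def ctxComparison (Γ : List Sg.Srt) : F.obj ⟨Γ⟩ ≅ listProd (fun σ => F.obj ⟨[σ]⟩) Γ :=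
  (F.mapIso (eqToIso (listProd_ctx h Γ))).symm ≪≫ listComparison (fun σ => ⟨[σ]⟩) F Γ

theorem ctxComparison_hom_listProj (Γ : List Sg.Srt) {τ : Sg.Srt} (x : Var Γ τ) :
    (ctxComparison h F Γ).hom ≫ listProj (fun σ => F.obj ⟨[σ]⟩) Γ τ x =
      F.map (ctxTerm h (.var x)) := by
  simp only [ctxComparison, Iso.trans_hom, Iso.symm_hom, Functor.mapIso_inv, Category.assoc]
  rw [listComparison_hom_listProj (fun σ => (⟨[σ]⟩ : Ctx h)) F Γ τ x, ← F.map_comp,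
    ← eqToHom_listProd_ctx]
  simp

theorem listComparison_inv_eq (Γ : List Sg.Srt) :
    (listComparison (fun σ => (⟨[σ]⟩ : Ctx h)) F Γ).inv ≫ F.map (eqToHom (listProd_ctx h Γ)) =
      (ctxComparison h F Γ).inv :=
  rfl

end ContextComparison

/-! ### The image of the generic structure -/

section Image

variable {𝓛 : Language.{l}} {Sg : Signature.{s}} {T : Theory 𝓛 Sg} (h : Constructible T)
  {X : PropCat.{l, u, v, w} 𝓛}

instance Hom.preservesFiniteProducts_ctx (F : Hom (classifying h) X) :
    Limits.PreservesFiniteProducts (C := Ctx h) F.functor :=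
  F.preserves

theorem Hom.mapStructure_generic_fn (F : Hom (classifying h) X) (f : Sg.Fn) :
    (F.mapStructure (generic h)).fn f = (ctxComparison h F.functor (Sg.dom f)).inv ≫
      F.functor.map (ctxTerm h (.app f fun _ x => .var x)) := by
  have e : (fnSubst f : Subst Sg [Sg.cod f] (Sg.dom f)) = Subst.one (.app f fun _ x => .var x) := by
    funext τ x
    rcases x with _ | x
    · rfl
    · exact x.nil_elim.elim
  simp only [mapStructure, generic, e]
  rw [← listComparison_inv_eq, Category.assoc, ← F.functor.map_comp]
  rfl

theorem Hom.mapStructure_generic_rel (F : Hom (classifying h) X) (R : Sg.Rel) :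
    (F.mapStructure (generic h)).rel R = X.pull (ctxComparison h F.functor (Sg.relDom R)).inv
      (F.app ⟨Sg.relDom R⟩ (PForm.mk h (.rel R fun _ x => .var x))) := by
  rw [← listComparison_inv_eq, X.pull_comp, ← F.naturality]
  rfl

namespace Structure

variable {S : Structure Sg X}

/-- The model functor sends each variable to the corresponding projection, so the comparison has the
same components as the identity. -/
theorem ctxComparison_modelFunctor (hS : S.IsModel T) (Γ : List Sg.Srt) :
    (ctxComparison h (S.modelFunctor h hS) Γ).inv = 𝟙 (listProd S.sort Γ) := by
  have e : (ctxComparison h (S.modelFunctor h hS) Γ).hom = 𝟙 (listProd S.sort Γ) := by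
    refine listProd_hom_ext S.sort Γ fun τ x => ?_
    exact (ctxComparison_hom_listProj h (S.modelFunctor h hS) Γ x).trans (Category.id_comp _).symm
  exact (Category.comp_id _).symm.trans
    ((congrArg (_ ≫ ·) e.symm).trans (ctxComparison h (S.modelFunctor h hS) Γ).inv_hom_id)

theorem modelHom_mapStructure_generic (hX : X.IsFA) (hS : S.IsModel T) :
    (S.modelHom h hX hS).mapStructure (generic h) = S := by
  have hfn : ((S.modelHom h hX hS).mapStructure (generic h)).fn = S.fn := by
    funext f
    rw [Hom.mapStructure_generic_fn]
    refine (congrArg (· ≫ _) (ctxComparison_modelFunctor h hS (Sg.dom f))).trans ?_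
    refine (Category.id_comp _).trans ?_
    exact (congrArg (· ≫ S.fn f) (listLift_eq_id S.sort (Sg.dom f))).trans (Category.id_comp _)
  have hrel : ((S.modelHom h hX hS).mapStructure (generic h)).rel = S.rel := by
    funext R
    rw [Hom.mapStructure_generic_rel]
    refine (congrArg (X.pull · _) (ctxComparison_modelFunctor h hS (Sg.relDom R))).trans ?_
    refine (X.pull_id _).trans ?_
    exact (congrArg (X.pull · (S.rel R)) (listLift_eq_id S.sort (Sg.relDom R))).trans
      (X.pull_id _)
  -- The sorts agree by definition, so the other two fields can be compared without transport.
  exact congr (congrArg (Structure.mk S.sort) hfn) hrel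

end Structure

/-! ### Uniqueness up to 2-isomorphism -/

namespace Hom

variable {h}
variable (H : Hom (classifying h) X)

/-- The componentwise hypothesis lets this serve inside the induction of `map_ctxTerm`, where it is
the induction hypothesis for the arguments of a function symbol. -/
theorem map_ctxHom {Γ Δ : List Sg.Srt} (γ : Subst Sg Γ Δ)
    (hγ : ∀ τ x, H.functor.map (ctxTerm h (γ τ x)) =
      (ctxComparison h H.functor Δ).hom ≫ (H.mapStructure (generic h)).term (γ τ x)) :
    H.functor.map (ctxHom h (Γ := ⟨Γ⟩) (Δ := ⟨Δ⟩) γ) ≫ (ctxComparison h H.functor Γ).hom =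
      (ctxComparison h H.functor Δ).hom ≫ (H.mapStructure (generic h)).subst γ := by
  refine listProd_hom_ext _ Γ fun τ x => ?_
  refine (Category.assoc _ _ _).trans (Eq.trans ?_ (Category.assoc _ _ _).symm)
  refine Eq.trans ?_ (congrArg ((ctxComparison h H.functor Δ).hom ≫ ·)
    (Structure.subst_listProj (H.mapStructure (generic h)) γ τ x).symm)
  refine Eq.trans ?_ (hγ τ x)
  refine (congrArg (_ ≫ ·) (ctxComparison_hom_listProj h H.functor Γ x)).trans ?_
  rw [← H.functor.map_comp]
  exact congrArg H.functor.map (ctxHom_comp_ctxTerm h γ (.var x))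

theorem map_ctxTerm {Γ : List Sg.Srt} {σ : Sg.Srt} (M : Term Sg Γ σ) :
    H.functor.map (ctxTerm h M) =
      (ctxComparison h H.functor Γ).hom ≫ (H.mapStructure (generic h)).term M := by
  induction M with
  | var x => exact (ctxComparison_hom_listProj h H.functor Γ x).symm
  | app f args ih =>
    -- The term factors as its argument list followed by the generic term `f(x₁, …, xₙ)`, whose
    -- image is known from `mapStructure_generic_fn`.
    have e : H.functor.map (ctxTerm h (.app f args)) =
        (H.functor.map (ctxHom h (Γ := ⟨Sg.dom f⟩) (Δ := ⟨_⟩) args) ≫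
          (ctxComparison h H.functor (Sg.dom f)).hom) ≫
            (ctxComparison h H.functor (Sg.dom f)).inv ≫
              H.functor.map (ctxTerm h (.app f fun _ x => .var x)) := by
      rw [Category.assoc, Iso.hom_inv_id_assoc, ← H.functor.map_comp]
      exact congrArg H.functor.map
        (ctxHom_comp_ctxTerm h args (.app f fun _ x => .var x)).symm
    rw [Structure.term, mapStructure_generic_fn]
    exact e.trans ((congrArg (· ≫ _) (H.map_ctxHom args ih)).trans (Category.assoc _ _ _))

theorem map_ctxHom_comp_ctxComparison {Γ Δ : List Sg.Srt} (γ : Subst Sg Γ Δ) :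
    H.functor.map (ctxHom h (Γ := ⟨Γ⟩) (Δ := ⟨Δ⟩) γ) ≫ (ctxComparison h H.functor Γ).hom =
      (ctxComparison h H.functor Δ).hom ≫ (H.mapStructure (generic h)).subst γ :=
  H.map_ctxHom γ fun _ _ => H.map_ctxTerm _

/-- Relates the product comparison used by `app_quant` to the `listSnoc` used in interpreting a
quantifier. -/
theorem prodComparison_inv_ctxComparison (Γ : List Sg.Srt) (σ : Sg.Srt) :
    (prodComparisonIso H.functor (⟨Γ⟩ : Ctx h) ⟨[σ]⟩).inv ≫
        (ctxComparison h H.functor (σ :: Γ)).hom =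
      (ctxComparison h H.functor Γ).hom ▷ H.functor.obj ⟨[σ]⟩ ≫
        listSnoc (fun σ => H.functor.obj ⟨[σ]⟩) σ Γ := by
  refine (Iso.inv_comp_eq _).2 (listProd_hom_ext _ _ fun τ x => ?_)
  refine (ctxComparison_hom_listProj h H.functor (σ :: Γ) x).trans (Eq.symm ?_)
  refine (Category.assoc _ _ _).trans ((congrArg (_ ≫ ·) (Category.assoc _ _ _)).trans ?_)
  cases x with
  | z =>
    rw [listSnoc_listProj_z, whiskerRight_snd]
    exact (prodComparison_snd ..).trans (congrArg H.functor.map (snd_eq_ctxTerm h))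
  | s x =>
    rw [listSnoc_listProj_s, whiskerRight_fst_assoc, ctxComparison_hom_listProj]
    refine (prodComparison_fst_assoc ..).trans ?_
    rw [← H.functor.map_comp]
    exact congrArg H.functor.map (fst_comp_ctxTerm h (Γ := ⟨Γ⟩) x)

theorem pull_ctxComparison_hom_inv {Γ : List Sg.Srt} (a : X.Pred (H.functor.obj ⟨Γ⟩)) :
    X.pull (ctxComparison h H.functor Γ).hom (X.pull (ctxComparison h H.functor Γ).inv a) = a := by
  rw [← X.pull_comp, Iso.hom_inv_id, X.pull_id]

/-- Equality formulas are interpreted by pulling back the equality predicate of a context. -/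
theorem mk_eq {Γ : List Sg.Srt} {σ : Sg.Srt} (M N : Term Sg Γ σ) :
    PForm.mk h (.eq M N) = (classifying h).pull
      (lift (ctxTerm h M) (ctxTerm h N)) ((classifying h).Eq (⟨[σ]⟩ : Ctx h)) :=
  rfl

/-- An atomic formula is a substitution instance of a generic one or of `Eq` on a sort, handled by
naturality of `H`. Connectives and quantifiers are preserved by `H`, and the laws in `hX` move them
past the comparison isomorphism. -/
theorem app_mk (hX : X.IsFA) {Γ : List Sg.Srt} (φ : Formula 𝓛 Sg Γ) :
    H.app ⟨Γ⟩ (PForm.mk h φ) =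
      X.pull (ctxComparison h H.functor Γ).hom ((H.mapStructure (generic h)).formula φ) := by
  induction φ with
  | @rel Γ R args =>
    have e : H.app ⟨Γ⟩ (PForm.mk h (.rel R args)) =
        X.pull (H.functor.map (ctxHom h (Γ := ⟨Sg.relDom R⟩) (Δ := ⟨Γ⟩) args))
          (H.app ⟨Sg.relDom R⟩ (PForm.mk h (.rel R fun _ x => .var x))) :=
      H.naturality (ctxHom h (Γ := ⟨Sg.relDom R⟩) (Δ := ⟨Γ⟩) args)
        (PForm.mk h (.rel R fun _ x => .var x))
    rw [← H.pull_ctxComparison_hom_inv (H.app ⟨Sg.relDom R⟩ _), ← X.pull_comp] at e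
    rw [e, Structure.formula, mapStructure_generic_rel]
    exact (congrArg (X.pull · _) (H.map_ctxHom_comp_ctxComparison args)).trans (X.pull_comp _ _ _)
  | @eq Γ σ M N =>
    have e : H.functor.map (lift (ctxTerm h M) (ctxTerm h N)) ≫
        prodComparison H.functor (⟨[σ]⟩ : Ctx h) ⟨[σ]⟩ =
          lift (H.functor.map (ctxTerm h M)) (H.functor.map (ctxTerm h N)) := by
      refine CartesianMonoidalCategory.hom_ext _ _ ?_ ?_
      · rw [Category.assoc, prodComparison_fst, ← H.functor.map_comp]
        simp
      · rw [Category.assoc, prodComparison_snd, ← H.functor.map_comp]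
        simp
    rw [mk_eq, H.naturality, H.app_Eq, ← X.pull_comp, Structure.formula]
    refine (congrArg (X.pull · _) e).trans ?_
    rw [map_ctxTerm, map_ctxTerm]
    exact (congrArg (X.pull · _) (comp_lift ..).symm).trans (X.pull_comp _ _ _)
  | @conn Γ n k φ ih =>
    have e : PForm.mk h (.conn k φ) =
        (classifying h).conn ⟨Γ⟩ k fun i => PForm.mk h (φ i) :=
      (PForm.conn_mk h k φ).symm
    rw [e, H.app_conn, Structure.formula]
    exact (congrArg _ (funext ih)).trans
      (hX.pull_conn (ctxComparison h H.functor Γ).hom k _).symm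
  | @quant Γ Q σ φ ih =>
    have e : PForm.mk h (.quant Q σ φ) =
      (classifying h).quant Q ⟨Γ⟩ ⟨[σ]⟩ (PForm.mk h φ) := rfl
    rw [e, H.app_quant, Structure.formula]
    refine Eq.trans ?_ (hX.quant_natural Q (ctxComparison h H.functor Γ).hom _ _)
    refine congrArg (X.quant Q _ _) ?_
    refine (congrArg (X.pull _) ih).trans ((X.pull_comp _ _ _).symm.trans ?_)
    exact (congrArg (X.pull · _) (H.prodComparison_inv_ctxComparison Γ σ)).trans
      (X.pull_comp _ _ _)

theorem twoIsomorphic_modelHom (hX : X.IsFA) (hS : (H.mapStructure (generic h)).IsModel T) :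
    H.TwoIsomorphic ((H.mapStructure (generic h)).modelHom h hX hS) := by
  refine ⟨⟨{ app Γ := (ctxComparison h H.functor Γ.sorts).hom, naturality := ?_ }, ?_⟩, ?_⟩
  · rintro Δ Γ ⟨γ⟩
    exact H.map_ctxHom_comp_ctxComparison γ
  · rintro Γ ⟨φ⟩
    exact H.app_mk hX φ
  · have (Γ : Ctx h) : IsIso (ctxComparison h H.functor Γ.sorts).hom := inferInstance
    exact @NatIso.isIso_of_isIso_app _ _ _ _ _ _ _ this

end Hom

end Image

end FOL

end

theorem mainTheorem8 {𝓛 : FOL.Language.{l}} (L : FOL.Logic.{l, s} 𝓛) (hL : L.Adequate)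
    {Sg : FOL.Signature.{s}} (T : FOL.Theory 𝓛 Sg) (hT : L.IsTheory T)
    (X : FOL.FA.{l, u, v, w} 𝓛) (S : FOL.Structure Sg X.toPropCat) (hS : S.IsModel T) :
    ∃ F : FOL.Hom (hL.classifyingFA hT).toPropCat X.toPropCat,
      F.mapStructure (hL.genericModel hT) = S ∧
      ∀ H : FOL.Hom (hL.classifyingFA hT).toPropCat X.toPropCat,
        H.mapStructure (hL.genericModel hT) = S → H.TwoIsomorphic F := by
  refine ⟨S.modelHom (hL.constructible hT) X.isFA hS,
    FOL.Structure.modelHom_mapStructure_generic _ X.isFA hS, fun H hH => ?_⟩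
  -- Replacing `S` by the image under `H` makes the comparison isomorphisms end, by definition, at
  -- the values of the model functor.
  subst hH
  exact FOL.Hom.twoIsomorphic_modelHom H X.isFA hS
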